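/- **Theorem 5.5.** Let $a<b$ and $c<d$ be real, let $n,m\ge 0$ be integers, let $\varphi_1,\dots,\varphi_n$ be an orthonormal system in the complex space $L_2[a,b]$, $\psi_1,\dots,\psi_m$ an orthonormal system in $L_2[c,d]$, and let $h_1,\dots,h_n$ and $p_1,\dots,p_m$ be essentially bounded real functions on $[c,d]$ and $[a,b]$ respectively. On $L_2([a,b]\times[c,d])$ define the bounded self-adjoint partial integral operators $$T_1f(x,y)=\int_a^b\sum_{k=1}^n\varphi_k(x)\overline{\varphi_k(s)}h_k(y)f(s,y)\,ds,\qquad T_2f(x,y)=\int_c^d\sum_{j=1}^m p_j(x)\psi_j(y)\overline{\psi_j(t)}f(x,t)\,dt,$$ and $T=T_1+T_2$. Let $\sigma$ denote the spectrum, $\rho$ the resolvent set, $E$ the identity, and let $\sigma_{disc}(T)$ be the set of isolated points of $\sigma(T)$ that are eigenvalues of finite multiplicity. For $\tau\ne0$ with $\tau^{-1}\in\rho(T_1)\cap\rho(T_2)$ put $$S_1(\tau)f(x,y)=\sum_{k=1}^n\frac{h_k(y)}{1-\tau h_k(y)}\int_a^b\varphi_k(x)\overline{\varphi_k(s)}f(s,y)\,ds,\qquad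 W_1(\tau)=(E-\tau T_2)^{-1}S_1(\tau)T_2 .$$ The operator $W_1(\tau)$ has finite rank; let $\Delta_1(\tau)$ be the Fredholm determinant of $E-\tau^2W_1(\tau)$ (for an operator $A$ of finite rank, the Fredholm determinant of $E-A$ is the determinant of the restriction of $E-A$ to the range of $A$), and let $$\mathcal D_0(T)=\{1/\tau:\ \tau\neq0,\ \tau^{-1}\in\rho(T_1)\cap\rho(T_2),\ \Delta_1(\tau)=0\}.$$ For $\lambda\in G=\mathbb C\setminus(\sigma(T_1)\cup\sigma(T_2))$, $1\le k\le m$ and $1\le j\le n$ let $$F_{k,j}(x,y;\lambda)=\varphi_j(x)\Bigl(\frac{\psi_k(y)h_j(y)}{\lambda-h_j(y)}+\sum_{i=1}^m\frac{p_i(x)\psi_i(y)}{\lambda-p_i(x)}\int_c^d\frac{h_j(\xi)}{\lambda-h_j(\xi)}\psi_k(\xi)\overline{\psi_i(\xi)}\,d\xi\Bigr),\qquad B_{k,j}(s,t)=p_k(s)\overline{\varphi_j(s)}\,\overline{\psi_k(t)},$$ let $\Pi(\lambda)$ be the $mn\times mn$ matrix, indexed by pairs $\omega=(k,j)$, with entries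 $\Pi_{\omega,\omega'}(\lambda)=\int_a^b\int_c^dF_\omega(x,y;\lambda)B_{\omega'}(x,y)\,dx\,dy$, and let $\Delta(\lambda)=\det(\Pi(\lambda)-\lambda I)$. Then $$\sigma_{disc}(T)=\mathcal D_0(T)=\{\lambda\in G:\ \Delta(\lambda)=0\}.$$ -/

import Mathlib

open MeasureTheory Set
open scoped ENNReal ComplexConjugate


noncomputable section

namespace PartialInt

section General

variable {α β : Type*} [MeasurableSpace α] [MeasurableSpace β]

/-! ### Partial integration against a rank-one kernel -/

/-- `(x, y) ↦ ∫ φ(x) * conj φ(s) * f(s, y) dμ(s)`. -/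
def projFun₁ (μ : Measure α) (φ : α → ℂ) (f : α × β → ℂ) (z : α × β) : ℂ :=
  ∫ s, φ z.1 * conj (φ s) * f (s, z.2) ∂μ

/-- `(x, y) ↦ ∫ ψ(y) * conj ψ(t) * f(x, t) dν(t)`. -/
def projFun₂ (ν : Measure β) (ψ : β → ℂ) (f : α × β → ℂ) (z : α × β) : ℂ :=
  ∫ t, ψ z.2 * conj (ψ t) * f (z.1, t) ∂ν

variable {μ : Measure α} {ν : Measure β} [SFinite μ] [SFinite ν]

theorem lintegral_enorm_sq_eq {γ : Type*} [MeasurableSpace γ] (ρ : Measure γ) (f : γ → ℂ) :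
    ∫⁻ z, ‖f z‖ₑ ^ (2 : ℝ) ∂ρ = (eLpNorm f 2 ρ) ^ (2 : ℝ) := by
  rw [eLpNorm_eq_lintegral_rpow_enorm_toReal two_ne_zero ENNReal.ofNat_ne_top]
  simp only [ENNReal.toReal_ofNat]
  rw [← ENNReal.rpow_mul]
  norm_num

theorem aestronglyMeasurable_projFun₁ {φ : α → ℂ} {f : α × β → ℂ}
    (hφ : AEStronglyMeasurable φ μ) (hf : AEStronglyMeasurable f (μ.prod ν)) :
    AEStronglyMeasurable (projFun₁ (β := β) μ φ f) (μ.prod ν) := by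
  have h1 : AEStronglyMeasurable (fun w : β × α => conj (φ w.2) * f (w.2, w.1)) (ν.prod μ) := by
    refine AEStronglyMeasurable.mul ?_ hf.prod_swap
    exact (RCLike.continuous_conj.comp_aestronglyMeasurable hφ).comp_snd
  have h2 : AEStronglyMeasurable (fun y => ∫ s, conj (φ s) * f (s, y) ∂μ) ν :=
    h1.integral_prod_right'
  have h3 : projFun₁ (β := β) μ φ f =
      fun z : α × β => φ z.1 * ∫ s, conj (φ s) * f (s, z.2) ∂μ := by
    funext z
    simp only [projFun₁, mul_assoc, integral_const_mul]
  rw [h3]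
  exact hφ.comp_fst.mul h2.comp_snd

theorem eLpNorm_projFun₁_le {φ : α → ℂ} {f : α × β → ℂ}
    (hφ : AEStronglyMeasurable φ μ) (hf : AEStronglyMeasurable f (μ.prod ν)) :
    eLpNorm (projFun₁ (β := β) μ φ f) 2 (μ.prod ν) ≤
      eLpNorm φ 2 μ * eLpNorm φ 2 μ * eLpNorm f 2 (μ.prod ν) := by
  have hfs : AEStronglyMeasurable (fun w : β × α => f w.swap) (ν.prod μ) := hf.prod_swap
  have key : ∫⁻ z, ‖projFun₁ (β := β) μ φ f z‖ₑ ^ (2 : ℝ) ∂(μ.prod ν) ≤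
      (eLpNorm φ 2 μ * eLpNorm φ 2 μ * eLpNorm f 2 (μ.prod ν)) ^ (2 : ℝ) := by
    have hB : AEMeasurable (fun y => ∫⁻ s, ‖f (s, y)‖ₑ ^ (2 : ℝ) ∂μ) ν :=
      (hfs.enorm.pow_const (2 : ℝ)).lintegral_prod_right'
    calc ∫⁻ z, ‖projFun₁ (β := β) μ φ f z‖ₑ ^ (2 : ℝ) ∂(μ.prod ν)
        ≤ ∫⁻ z : α × β, ‖φ z.1‖ₑ ^ (2 : ℝ) *
            ((eLpNorm φ 2 μ) ^ (2 : ℝ) * ∫⁻ s, ‖f (s, z.2)‖ₑ ^ (2 : ℝ) ∂μ) ∂(μ.prod ν) := by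
          have hsec : ∀ᵐ y ∂ν, AEStronglyMeasurable (fun s => f (s, y)) μ :=
            hfs.prodMk_left
          have hsec' : ∀ᵐ z ∂(μ.prod ν), AEStronglyMeasurable (fun s => f (s, z.2)) μ :=
            Measure.quasiMeasurePreserving_snd.ae hsec
          refine lintegral_mono_ae ?_
          filter_upwards [hsec'] with z hz
          have e : projFun₁ (β := β) μ φ f z = φ z.1 * ∫ s, conj (φ s) * f (s, z.2) ∂μ := by
            simp only [projFun₁, mul_assoc, integral_const_mul]
          rw [e, enorm_mul, ENNReal.mul_rpow_of_nonneg _ _ (by norm_num)]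
          gcongr
          have h1 : ‖∫ s, conj (φ s) * f (s, z.2) ∂μ‖ₑ ≤
              (∫⁻ s, ‖φ s‖ₑ ^ (2 : ℝ) ∂μ) ^ (1 / (2 : ℝ)) *
                (∫⁻ s, ‖f (s, z.2)‖ₑ ^ (2 : ℝ) ∂μ) ^ (1 / (2 : ℝ)) := by
            refine (enorm_integral_le_lintegral_enorm _).trans ?_
            have := ENNReal.lintegral_mul_le_Lp_mul_Lq μ Real.HolderConjugate.two_two
              hφ.enorm hz.enorm
            refine le_trans (le_of_eq ?_) this
            refine lintegral_congr fun s => ?_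
            simp [enorm_mul]
          refine (ENNReal.rpow_le_rpow h1 (by norm_num)).trans (le_of_eq ?_)
          rw [ENNReal.mul_rpow_of_nonneg _ _ (by norm_num), ← ENNReal.rpow_mul,
            ← ENNReal.rpow_mul, lintegral_enorm_sq_eq]
          norm_num
      _ = (∫⁻ x, ‖φ x‖ₑ ^ (2 : ℝ) ∂μ) *
            ∫⁻ y, ((eLpNorm φ 2 μ) ^ (2 : ℝ) * ∫⁻ s, ‖f (s, y)‖ₑ ^ (2 : ℝ) ∂μ) ∂ν :=
          lintegral_prod_mul (hφ.enorm.pow_const _) (hB.const_mul _)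
      _ = (eLpNorm φ 2 μ * eLpNorm φ 2 μ * eLpNorm f 2 (μ.prod ν)) ^ (2 : ℝ) := by
          rw [lintegral_const_mul'' _ hB, lintegral_enorm_sq_eq,
            ← lintegral_prod_symm _ (hf.enorm.pow_const (2 : ℝ)), lintegral_enorm_sq_eq,
            ← mul_assoc, ← ENNReal.mul_rpow_of_nonneg _ _ (by norm_num),
            ← ENNReal.mul_rpow_of_nonneg _ _ (by norm_num)]
  rw [lintegral_enorm_sq_eq] at key
  exact (ENNReal.rpow_le_rpow_iff (by norm_num)).1 key

theorem memLp_projFun₁ {φ : α → ℂ} {f : α × β → ℂ}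
    (hφ : MemLp φ 2 μ) (hf : MemLp f 2 (μ.prod ν)) :
    MemLp (projFun₁ (β := β) μ φ f) 2 (μ.prod ν) :=
  ⟨aestronglyMeasurable_projFun₁ hφ.1 hf.1, (eLpNorm_projFun₁_le hφ.1 hf.1).trans_lt
    (ENNReal.mul_lt_top (ENNReal.mul_lt_top hφ.2 hφ.2) hf.2)⟩

theorem ae_section_snd {q : α × β → Prop} (h : ∀ᵐ z ∂(μ.prod ν), q z) :
    ∀ᵐ z ∂(μ.prod ν), ∀ᵐ s ∂μ, q (s, z.2) := by
  have h1 : ∀ᵐ w ∂(ν.prod μ), q w.swap := by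
    have := Measure.measurePreserving_swap (μ := ν) (ν := μ)
    exact this.quasiMeasurePreserving.ae h
  exact Measure.quasiMeasurePreserving_snd.ae (Measure.ae_ae_of_ae_prod h1)

theorem ae_section_fst {q : α × β → Prop} (h : ∀ᵐ z ∂(μ.prod ν), q z) :
    ∀ᵐ z ∂(μ.prod ν), ∀ᵐ t ∂ν, q (z.1, t) :=
  Measure.quasiMeasurePreserving_fst.ae (Measure.ae_ae_of_ae_prod h)

theorem projFun₁_congr {φ : α → ℂ} {f g : α × β → ℂ} (h : f =ᵐ[μ.prod ν] g) :
    projFun₁ (β := β) μ φ f =ᵐ[μ.prod ν] projFun₁ (β := β) μ φ g := by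
  filter_upwards [ae_section_snd h] with z hz
  refine integral_congr_ae ?_
  filter_upwards [hz] with s hs
  rw [hs]

theorem ae_integrable_section₁ {φ : α → ℂ} {f : α × β → ℂ}
    (hφ : MemLp φ 2 μ) (hf : MemLp f 2 (μ.prod ν)) :
    ∀ᵐ z ∂(μ.prod ν), Integrable (fun s => φ z.1 * conj (φ s) * f (s, z.2)) μ := by
  have hfs : MemLp (fun w : β × α => f w.swap) 2 (ν.prod μ) :=
    hf.comp_measurePreserving Measure.measurePreserving_swap
  have h2 : Integrable (fun w : β × α => ‖f w.swap‖ ^ 2) (ν.prod μ) :=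
    hfs.integrable_norm_pow two_ne_zero
  have h3 : ∀ᵐ y ∂ν, Integrable (fun s => ‖f (s, y)‖ ^ 2) μ := h2.prod_right_ae
  have h4 : ∀ᵐ y ∂ν, AEStronglyMeasurable (fun s => f (s, y)) μ := hfs.1.prodMk_left
  have h5 : ∀ᵐ y ∂ν, MemLp (fun s => f (s, y)) 2 μ := by
    filter_upwards [h3, h4] with y hy hy'
    exact (memLp_two_iff_integrable_sq_norm hy').2 hy
  filter_upwards [Measure.quasiMeasurePreserving_snd.ae h5] with z hz
  have : Integrable (fun s => conj (φ s) * f (s, z.2)) μ :=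
    MemLp.integrable_mul (p := 2) (q := 2) hφ.star hz
  simpa only [mul_assoc] using this.const_mul (φ z.1)

theorem projFun₂_eq (ψ : β → ℂ) (f : α × β → ℂ) :
    projFun₂ (α := α) ν ψ f = fun z => projFun₁ ν ψ (fun w : β × α => f w.swap) z.swap := rfl

theorem memLp_projFun₂ {ψ : β → ℂ} {f : α × β → ℂ}
    (hψ : MemLp ψ 2 ν) (hf : MemLp f 2 (μ.prod ν)) :
    MemLp (projFun₂ (α := α) ν ψ f) 2 (μ.prod ν) := by
  have hfs : MemLp (fun w : β × α => f w.swap) 2 (ν.prod μ) :=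
    hf.comp_measurePreserving Measure.measurePreserving_swap
  exact (memLp_projFun₁ hψ hfs).comp_measurePreserving Measure.measurePreserving_swap

theorem eLpNorm_projFun₂_le {ψ : β → ℂ} {f : α × β → ℂ}
    (hψ : MemLp ψ 2 ν) (hf : MemLp f 2 (μ.prod ν)) :
    eLpNorm (projFun₂ (α := α) ν ψ f) 2 (μ.prod ν) ≤
      eLpNorm ψ 2 ν * eLpNorm ψ 2 ν * eLpNorm f 2 (μ.prod ν) := by
  have hsw : MeasurePreserving (Prod.swap : α × β → β × α) (μ.prod ν) (ν.prod μ) :=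
    Measure.measurePreserving_swap
  have hsw' : MeasurePreserving (Prod.swap : β × α → α × β) (ν.prod μ) (μ.prod ν) :=
    Measure.measurePreserving_swap
  have hfs : MemLp (f ∘ Prod.swap) 2 (ν.prod μ) := hf.comp_measurePreserving hsw'
  have h1 := eLpNorm_projFun₁_le hψ.1 hfs.1
  have h2 := eLpNorm_comp_measurePreserving (p := 2) hf.1 hsw'
  have h3 := eLpNorm_comp_measurePreserving (p := 2) (memLp_projFun₁ hψ hfs).1 hsw
  rw [h2, ← h3] at h1
  exact h1

theorem projFun₂_congr {ψ : β → ℂ} {f g : α × β → ℂ} (h : f =ᵐ[μ.prod ν] g) :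
    projFun₂ (α := α) ν ψ f =ᵐ[μ.prod ν] projFun₂ (α := α) ν ψ g := by
  filter_upwards [ae_section_fst h] with z hz
  refine integral_congr_ae ?_
  filter_upwards [hz] with s hs
  rw [hs]

theorem ae_integrable_section₂ {ψ : β → ℂ} {f : α × β → ℂ}
    (hψ : MemLp ψ 2 ν) (hf : MemLp f 2 (μ.prod ν)) :
    ∀ᵐ z ∂(μ.prod ν), Integrable (fun t => ψ z.2 * conj (ψ t) * f (z.1, t)) ν := by
  have hfs : MemLp (fun w : β × α => f w.swap) 2 (ν.prod μ) :=
    hf.comp_measurePreserving Measure.measurePreserving_swap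
  exact Measure.measurePreserving_swap.quasiMeasurePreserving.ae (ae_integrable_section₁ hψ hfs)

/-- A linear map of `L²` from a pointwise formula `F` that is compatible with a.e. equality,
square integrable, a.e. linear and bounded. -/
def ofFormula {γ : Type*} [MeasurableSpace γ] {ρ : Measure γ} (F : (γ → ℂ) → γ → ℂ)
    (hF : ∀ f : Lp ℂ 2 ρ, MemLp (F f) 2 ρ)
    (hadd : ∀ f g : Lp ℂ 2 ρ, F ⇑(f + g) =ᵐ[ρ] F f + F g)
    (hsmul : ∀ (c : ℂ) (f : Lp ℂ 2 ρ), F ⇑(c • f) =ᵐ[ρ] c • F f)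
    (C : ℝ≥0∞) (hC : C ≠ ∞) (hb : ∀ f : Lp ℂ 2 ρ, eLpNorm (F f) 2 ρ ≤ C * eLpNorm f 2 ρ) :
    Lp ℂ 2 ρ →L[ℂ] Lp ℂ 2 ρ :=
  LinearMap.mkContinuous
    { toFun := fun f => (hF f).toLp (F f)
      map_add' := fun f g => by
        rw [← MemLp.toLp_add, MemLp.toLp_eq_toLp_iff]
        exact hadd f g
      map_smul' := fun c f => by
        rw [RingHom.id_apply, ← MemLp.toLp_const_smul, MemLp.toLp_eq_toLp_iff]
        exact hsmul c f }
    C.toReal (fun f => by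
      change ‖(hF f).toLp (F f)‖ ≤ _
      rw [Lp.norm_toLp, Lp.norm_def, ← ENNReal.toReal_mul]
      exact ENNReal.toReal_mono (ENNReal.mul_ne_top hC (Lp.eLpNorm_ne_top f)) (hb f))

theorem coeFn_ofFormula {γ : Type*} [MeasurableSpace γ] {ρ : Measure γ} (F : (γ → ℂ) → γ → ℂ)
    (hF : ∀ f : Lp ℂ 2 ρ, MemLp (F f) 2 ρ)
    (hadd : ∀ f g : Lp ℂ 2 ρ, F ⇑(f + g) =ᵐ[ρ] F f + F g)
    (hsmul : ∀ (c : ℂ) (f : Lp ℂ 2 ρ), F ⇑(c • f) =ᵐ[ρ] c • F f)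
    (C : ℝ≥0∞) (hC : C ≠ ∞) (hb : ∀ f : Lp ℂ 2 ρ, eLpNorm (F f) 2 ρ ≤ C * eLpNorm f 2 ρ)
    (f : Lp ℂ 2 ρ) : ofFormula F hF hadd hsmul C hC hb f =ᵐ[ρ] F f :=
  MemLp.coeFn_toLp (hF f)

/-- `(P_φ f)(x, y) = ∫ φ(x) * conj φ(s) * f(s, y) dμ(s)` as a bounded operator on `L²`. -/
def P (φ : Lp ℂ 2 μ) : Lp ℂ 2 (μ.prod ν) →L[ℂ] Lp ℂ 2 (μ.prod ν) :=
  ofFormula (projFun₁ μ φ)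
    (fun f => memLp_projFun₁ (Lp.memLp φ) (Lp.memLp f))
    (fun f g => by
      refine (projFun₁_congr (Lp.coeFn_add f g)).trans ?_
      filter_upwards [ae_integrable_section₁ (Lp.memLp φ) (Lp.memLp f),
        ae_integrable_section₁ (Lp.memLp φ) (Lp.memLp g)] with z h1 h2
      simp only [projFun₁, Pi.add_apply, mul_add]
      exact integral_add h1 h2)
    (fun c f => by
      refine (projFun₁_congr (Lp.coeFn_smul c f)).trans (Filter.Eventually.of_forall fun z => ?_)
      simp only [projFun₁, Pi.smul_apply, smul_eq_mul]
      rw [← integral_const_mul]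
      congr 1
      funext s
      ring)
    (eLpNorm φ 2 μ * eLpNorm φ 2 μ)
    (ENNReal.mul_ne_top (Lp.eLpNorm_ne_top φ) (Lp.eLpNorm_ne_top φ))
    (fun f => eLpNorm_projFun₁_le (Lp.aestronglyMeasurable φ) (Lp.aestronglyMeasurable f))

theorem coeFn_P (φ : Lp ℂ 2 μ) (f : Lp ℂ 2 (μ.prod ν)) :
    P φ f =ᵐ[μ.prod ν] projFun₁ μ φ f :=
  coeFn_ofFormula ..

/-- `(Q_ψ f)(x, y) = ∫ ψ(y) * conj ψ(t) * f(x, t) dν(t)` as a bounded operator on `L²`. -/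
def Q (ψ : Lp ℂ 2 ν) : Lp ℂ 2 (μ.prod ν) →L[ℂ] Lp ℂ 2 (μ.prod ν) :=
  ofFormula (projFun₂ ν ψ)
    (fun f => memLp_projFun₂ (Lp.memLp ψ) (Lp.memLp f))
    (fun f g => by
      refine (projFun₂_congr (Lp.coeFn_add f g)).trans ?_
      filter_upwards [ae_integrable_section₂ (Lp.memLp ψ) (Lp.memLp f),
        ae_integrable_section₂ (Lp.memLp ψ) (Lp.memLp g)] with z h1 h2
      simp only [projFun₂, Pi.add_apply, mul_add]
      exact integral_add h1 h2)
    (fun c f => by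
      refine (projFun₂_congr (Lp.coeFn_smul c f)).trans (Filter.Eventually.of_forall fun z => ?_)
      simp only [projFun₂, Pi.smul_apply, smul_eq_mul]
      rw [← integral_const_mul]
      congr 1
      funext s
      ring)
    (eLpNorm ψ 2 ν * eLpNorm ψ 2 ν)
    (ENNReal.mul_ne_top (Lp.eLpNorm_ne_top ψ) (Lp.eLpNorm_ne_top ψ))
    (fun f => eLpNorm_projFun₂_le (Lp.memLp ψ) (Lp.memLp f))

theorem coeFn_Q (ψ : Lp ℂ 2 ν) (f : Lp ℂ 2 (μ.prod ν)) :
    Q ψ f =ᵐ[μ.prod ν] projFun₂ ν ψ f :=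
  coeFn_ofFormula ..

/-! ### Multiplication operators -/

theorem eLpNorm_mul_top_le {γ : Type*} [MeasurableSpace γ] {ρ : Measure γ} {g f : γ → ℂ}
    (hg : MemLp g ∞ ρ) (hf : MemLp f 2 ρ) :
    eLpNorm (fun z => g z * f z) 2 ρ ≤ eLpNorm g ∞ ρ * eLpNorm f 2 ρ :=
  eLpNorm_smul_le_eLpNorm_top_mul_eLpNorm 2 hf.1 g

open Classical in
/-- Multiplication by `g` on `L²`, for an essentially bounded `g` (and `0` for any other `g`). -/
def mulOp {γ : Type*} [MeasurableSpace γ] (ρ : Measure γ) (g : γ → ℂ) :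
    Lp ℂ 2 ρ →L[ℂ] Lp ℂ 2 ρ :=
  if hg : MemLp g ∞ ρ then
    ofFormula (fun f z => g z * f z)
      (fun f => (Lp.memLp f).mul' hg)
      (fun f₁ f₂ => by
        filter_upwards [Lp.coeFn_add f₁ f₂] with z hz
        simp only [hz, Pi.add_apply, mul_add])
      (fun c f => by
        filter_upwards [Lp.coeFn_smul c f] with z hz
        simp only [hz, Pi.smul_apply, smul_eq_mul]
        ring)
      (eLpNorm g ∞ ρ) hg.2.ne (fun f => eLpNorm_mul_top_le hg (Lp.memLp f))
  else 0

theorem coeFn_mulOp {γ : Type*} [MeasurableSpace γ] {ρ : Measure γ} {g : γ → ℂ}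
    (hg : MemLp g ∞ ρ) (f : Lp ℂ 2 ρ) : mulOp ρ g f =ᵐ[ρ] fun z => g z * f z := by
  rw [mulOp, dif_pos hg]
  exact coeFn_ofFormula ..

theorem memLp_ofReal_snd (h : Lp ℝ ∞ ν) :
    MemLp (fun z : α × β => ((h z.2 : ℝ) : ℂ)) ∞ (μ.prod ν) := by
  have hm : MemLp (fun x => ((h x : ℝ) : ℂ)) ∞ ν := (Lp.memLp h).ofReal
  refine ⟨hm.1.comp_snd, lt_of_le_of_lt ?_ hm.2⟩
  rw [eLpNorm_exponent_top, eLpNorm_exponent_top]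
  exact essSup_le_of_ae_le _ (Measure.quasiMeasurePreserving_snd.ae ae_le_eLpNormEssSup)

theorem memLp_ofReal_fst (p : Lp ℝ ∞ μ) :
    MemLp (fun z : α × β => ((p z.1 : ℝ) : ℂ)) ∞ (μ.prod ν) := by
  have hm : MemLp (fun x => ((p x : ℝ) : ℂ)) ∞ μ := (Lp.memLp p).ofReal
  refine ⟨hm.1.comp_fst, lt_of_le_of_lt ?_ hm.2⟩
  rw [eLpNorm_exponent_top, eLpNorm_exponent_top]
  exact essSup_le_of_ae_le _ (Measure.quasiMeasurePreserving_fst.ae ae_le_eLpNormEssSup)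

/-! ### The partial integral operators with degenerate kernels -/

section Operators

variable {n m : ℕ}

/-- `k₁(x, s, y) = ∑ₖ φₖ(x) * conj φₖ(s) * hₖ(y)`. -/
def kernel₁ (φ : Fin n → Lp ℂ 2 μ) (h : Fin n → Lp ℝ ∞ ν) (x s : α) (y : β) : ℂ :=
  ∑ k, φ k x * conj (φ k s) * ((h k y : ℝ) : ℂ)

/-- `k₂(x, t, y) = ∑ⱼ pⱼ(x) * ψⱼ(y) * conj ψⱼ(t)`. -/
def kernel₂ (ψ : Fin m → Lp ℂ 2 ν) (p : Fin m → Lp ℝ ∞ μ) (x : α) (t y : β) : ℂ :=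
  ∑ j, ((p j x : ℝ) : ℂ) * ψ j y * conj (ψ j t)

/-- `(T₁ f)(x, y) = ∫ k₁(x, s, y) f(s, y) dμ(s)`, pointwise. -/
def T₁Fun (φ : Fin n → Lp ℂ 2 μ) (h : Fin n → Lp ℝ ∞ ν) (f : α × β → ℂ) (z : α × β) : ℂ :=
  ∫ s, kernel₁ φ h z.1 s z.2 * f (s, z.2) ∂μ

/-- `(T₂ f)(x, y) = ∫ k₂(x, t, y) f(x, t) dν(t)`, pointwise. -/
def T₂Fun (ψ : Fin m → Lp ℂ 2 ν) (p : Fin m → Lp ℝ ∞ μ) (f : α × β → ℂ) (z : α × β) : ℂ :=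
  ∫ t, kernel₂ ψ p z.1 t z.2 * f (z.1, t) ∂ν

theorem coeFn_sum_ae {γ ι : Type*} [MeasurableSpace γ] {ρ : Measure γ} (s : Finset ι)
    (F : ι → Lp ℂ 2 ρ) : ⇑(∑ i ∈ s, F i) =ᵐ[ρ] fun z => ∑ i ∈ s, F i z := by
  classical
  induction s using Finset.induction_on with
  | empty =>
    simp only [Finset.sum_empty]
    exact Lp.coeFn_zero ℂ 2 ρ
  | insert a s ha ih =>
    rw [Finset.sum_insert ha]
    filter_upwards [Lp.coeFn_add (F a) (∑ i ∈ s, F i), ih] with z h1 h2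
    rw [h1, Pi.add_apply, h2, Finset.sum_insert ha]

theorem T₁Fun_ae (φ : Fin n → Lp ℂ 2 μ) (h : Fin n → Lp ℝ ∞ ν) (f : Lp ℂ 2 (μ.prod ν)) :
    ⇑((∑ k, mulOp (μ.prod ν) (fun z => ((h k z.2 : ℝ) : ℂ)) ∘L P (φ k)) f)
      =ᵐ[μ.prod ν] T₁Fun φ h f := by
  rw [_root_.sum_apply]
  refine (coeFn_sum_ae _ _).trans ?_
  have h1 := ae_all_iff.2 fun k => coeFn_mulOp (memLp_ofReal_snd (μ := μ) (h k)) (P (φ k) f)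
  have h2 := ae_all_iff.2 fun k => coeFn_P (φ k) f
  have h3 := ae_all_iff.2 fun k => ae_integrable_section₁ (Lp.memLp (φ k)) (Lp.memLp f)
  filter_upwards [h1, h2, h3] with z h1 h2 h3
  simp only [T₁Fun, kernel₁, Finset.sum_mul]
  rw [integral_finsetSum]
  · refine Finset.sum_congr rfl fun k _ => ?_
    rw [ContinuousLinearMap.comp_apply, h1 k, h2 k, projFun₁, ← integral_const_mul]
    congr 1
    funext s
    ring
  · intro k _
    refine ((h3 k).const_mul ((h k z.2 : ℝ) : ℂ)).congr (Filter.Eventually.of_forall fun s => ?_)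
    simp only
    ring

theorem T₂Fun_ae (ψ : Fin m → Lp ℂ 2 ν) (p : Fin m → Lp ℝ ∞ μ) (f : Lp ℂ 2 (μ.prod ν)) :
    ⇑((∑ j, mulOp (μ.prod ν) (fun z => ((p j z.1 : ℝ) : ℂ)) ∘L Q (ψ j)) f)
      =ᵐ[μ.prod ν] T₂Fun ψ p f := by
  rw [_root_.sum_apply]
  refine (coeFn_sum_ae _ _).trans ?_
  have h1 := ae_all_iff.2 fun j => coeFn_mulOp (memLp_ofReal_fst (ν := ν) (p j)) (Q (ψ j) f)
  have h2 := ae_all_iff.2 fun j => coeFn_Q (ψ j) f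
  have h3 := ae_all_iff.2 fun j => ae_integrable_section₂ (Lp.memLp (ψ j)) (Lp.memLp f)
  filter_upwards [h1, h2, h3] with z h1 h2 h3
  simp only [T₂Fun, kernel₂, Finset.sum_mul]
  rw [integral_finsetSum]
  · refine Finset.sum_congr rfl fun j _ => ?_
    rw [ContinuousLinearMap.comp_apply, h1 j, h2 j, projFun₂, ← integral_const_mul]
    congr 1
    funext s
    ring
  · intro j _
    refine ((h3 j).const_mul ((p j z.1 : ℝ) : ℂ)).congr (Filter.Eventually.of_forall fun s => ?_)
    simp only
    ring

theorem memLp_T₁Fun (φ : Fin n → Lp ℂ 2 μ) (h : Fin n → Lp ℝ ∞ ν) (f : Lp ℂ 2 (μ.prod ν)) :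
    MemLp (T₁Fun φ h f) 2 (μ.prod ν) :=
  (memLp_congr_ae (T₁Fun_ae φ h f)).1 (Lp.memLp _)

theorem memLp_T₂Fun (ψ : Fin m → Lp ℂ 2 ν) (p : Fin m → Lp ℝ ∞ μ) (f : Lp ℂ 2 (μ.prod ν)) :
    MemLp (T₂Fun ψ p f) 2 (μ.prod ν) :=
  (memLp_congr_ae (T₂Fun_ae ψ p f)).1 (Lp.memLp _)

/-- The operator `(T₁ f)(x, y) = ∫ k₁(x, s, y) f(s, y) dμ(s)` on `L²(μ × ν)`. -/
def T₁ (φ : Fin n → Lp ℂ 2 μ) (h : Fin n → Lp ℝ ∞ ν) :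
    Lp ℂ 2 (μ.prod ν) →L[ℂ] Lp ℂ 2 (μ.prod ν) :=
  (∑ k, mulOp (μ.prod ν) (fun z => ((h k z.2 : ℝ) : ℂ)) ∘L P (φ k)).copy
    (fun f => (memLp_T₁Fun φ h f).toLp (T₁Fun φ h f))
    (funext fun f => Lp.ext ((MemLp.coeFn_toLp _).trans (T₁Fun_ae φ h f).symm))

/-- The operator `(T₂ f)(x, y) = ∫ k₂(x, t, y) f(x, t) dν(t)` on `L²(μ × ν)`. -/
def T₂ (ψ : Fin m → Lp ℂ 2 ν) (p : Fin m → Lp ℝ ∞ μ) :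
    Lp ℂ 2 (μ.prod ν) →L[ℂ] Lp ℂ 2 (μ.prod ν) :=
  (∑ j, mulOp (μ.prod ν) (fun z => ((p j z.1 : ℝ) : ℂ)) ∘L Q (ψ j)).copy
    (fun f => (memLp_T₂Fun ψ p f).toLp (T₂Fun ψ p f))
    (funext fun f => Lp.ext ((MemLp.coeFn_toLp _).trans (T₂Fun_ae ψ p f).symm))

theorem coeFn_T₁ (φ : Fin n → Lp ℂ 2 μ) (h : Fin n → Lp ℝ ∞ ν) (f : Lp ℂ 2 (μ.prod ν)) :
    T₁ φ h f =ᵐ[μ.prod ν] fun z => ∫ s, kernel₁ φ h z.1 s z.2 * f (s, z.2) ∂μ :=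
  MemLp.coeFn_toLp (memLp_T₁Fun φ h f)

theorem coeFn_T₂ (ψ : Fin m → Lp ℂ 2 ν) (p : Fin m → Lp ℝ ∞ μ) (f : Lp ℂ 2 (μ.prod ν)) :
    T₂ ψ p f =ᵐ[μ.prod ν] fun z => ∫ t, kernel₂ ψ p z.1 t z.2 * f (z.1, t) ∂ν :=
  MemLp.coeFn_toLp (memLp_T₂Fun ψ p f)

/-- `(S₁(τ) f)(x, y) = ∑ₖ hₖ(y) / (1 - τ hₖ(y)) * (Pₖ f)(x, y)`. The multipliers are essentially
bounded whenever `τ ≠ 0` and `τ⁻¹` lies in the resolvent set of `T₁`. -/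
def S₁ (φ : Fin n → Lp ℂ 2 μ) (h : Fin n → Lp ℝ ∞ ν) (τ : ℂ) :
    Lp ℂ 2 (μ.prod ν) →L[ℂ] Lp ℂ 2 (μ.prod ν) :=
  ∑ k, mulOp (μ.prod ν) (fun z => ((h k z.2 : ℝ) : ℂ) / (1 - τ * ((h k z.2 : ℝ) : ℂ)))
    ∘L P (φ k)

/-- `W₁(τ) = (E - τ T₂)⁻¹ S₁(τ) T₂`, for `τ ≠ 0` with `τ⁻¹` in both resolvent sets. -/
def W₁ (φ : Fin n → Lp ℂ 2 μ) (h : Fin n → Lp ℝ ∞ ν)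
    (ψ : Fin m → Lp ℂ 2 ν) (p : Fin m → Lp ℝ ∞ μ) (τ : ℂ) :
    Lp ℂ 2 (μ.prod ν) →L[ℂ] Lp ℂ 2 (μ.prod ν) :=
  Ring.inverse (1 - τ • T₂ ψ p) * S₁ φ h τ * T₂ ψ p

end Operators

end General

/-! ### Fredholm determinant and discrete spectrum -/

/-- The Fredholm determinant `det (E - A)` of a finite-rank operator `A`: the determinant of the
restriction of `E - A` to the (finite-dimensional, invariant) range of `A`. -/
def fredholmDet {H : Type*} [NormedAddCommGroup H] [NormedSpace ℂ H] (A : H →L[ℂ] H) : ℂ :=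
  LinearMap.det
    (LinearMap.id - (A : H →ₗ[ℂ] H).rangeRestrict ∘ₗ (LinearMap.range (A : H →ₗ[ℂ] H)).subtype)

/-- The discrete spectrum of a bounded self-adjoint operator: the isolated points of the spectrum
that are eigenvalues of finite multiplicity. -/
def discreteSpectrum {H : Type*} [NormedAddCommGroup H] [NormedSpace ℂ H] (A : H →L[ℂ] H) :
    Set ℂ :=
  {z | (∃ ε > 0, spectrum ℂ A ∩ Metric.ball z ε = {z}) ∧
    Module.End.HasEigenvalue (A : H →ₗ[ℂ] H) z ∧
    FiniteDimensional ℂ (Module.End.eigenspace (A : H →ₗ[ℂ] H) z)}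

section Main

variable {α β : Type*} [MeasurableSpace α] [MeasurableSpace β] {μ : Measure α} {ν : Measure β}
  [SFinite μ] [SFinite ν] {n m : ℕ}

/-- `𝒟(T)`: the `τ ≠ 0` with `τ⁻¹ ∈ ρ(T₁) ∩ ρ(T₂)` at which the Fredholm determinant
`Δ₁(τ) = det (E - τ² W₁(τ))` vanishes. -/
def D (φ : Fin n → Lp ℂ 2 μ) (h : Fin n → Lp ℝ ∞ ν)
    (ψ : Fin m → Lp ℂ 2 ν) (p : Fin m → Lp ℝ ∞ μ) : Set ℂ :=
  {τ | τ ≠ 0 ∧ τ⁻¹ ∈ resolventSet ℂ (T₁ φ h) ∩ resolventSet ℂ (T₂ ψ p) ∧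
    fredholmDet (τ ^ 2 • W₁ φ h ψ p τ) = 0}

/-- `𝒟₀(T) = {1 / τ : τ ∈ 𝒟(T)}`. -/
def D₀ (φ : Fin n → Lp ℂ 2 μ) (h : Fin n → Lp ℝ ∞ ν)
    (ψ : Fin m → Lp ℂ 2 ν) (p : Fin m → Lp ℝ ∞ μ) : Set ℂ :=
  {ξ | ∃ τ ∈ D φ h ψ p, ξ = 1 / τ}

/-- `G = ℂ ∖ (σ(T₁) ∪ σ(T₂))`. -/
def G (φ : Fin n → Lp ℂ 2 μ) (h : Fin n → Lp ℝ ∞ ν)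
    (ψ : Fin m → Lp ℂ 2 ν) (p : Fin m → Lp ℝ ∞ μ) : Set ℂ :=
  (spectrum ℂ (T₁ φ h) ∪ spectrum ℂ (T₂ ψ p))ᶜ

/-- The functions `F_{k,j}(x, y; λ)` of the degenerate kernel
`λ ∑_{j,k} F_{k,j}(x, y; λ) B_{k,j}(s, t)` of `W₁(1/λ)`. -/
def F (φ : Fin n → Lp ℂ 2 μ) (h : Fin n → Lp ℝ ∞ ν)
    (ψ : Fin m → Lp ℂ 2 ν) (p : Fin m → Lp ℝ ∞ μ) (l : ℂ) (ω : Fin m × Fin n)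
    (z : α × β) : ℂ :=
  φ ω.2 z.1 * (ψ ω.1 z.2 * ((h ω.2 z.2 : ℝ) : ℂ) / (l - ((h ω.2 z.2 : ℝ) : ℂ)) +
    ∑ i, ((p i z.1 : ℝ) : ℂ) * ψ i z.2 / (l - ((p i z.1 : ℝ) : ℂ)) *
      ∫ ξ, ((h ω.2 ξ : ℝ) : ℂ) / (l - ((h ω.2 ξ : ℝ) : ℂ)) * ψ ω.1 ξ * conj (ψ i ξ) ∂ν)

/-- The functions `B_{k,j}(s, t) = p_k(s) * conj φ_j(s) * conj ψ_k(t)`. -/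
def B (φ : Fin n → Lp ℂ 2 μ) (ψ : Fin m → Lp ℂ 2 ν) (p : Fin m → Lp ℝ ∞ μ)
    (ω : Fin m × Fin n) (z : α × β) : ℂ :=
  ((p ω.1 z.1 : ℝ) : ℂ) * conj (φ ω.2 z.1) * conj (ψ ω.1 z.2)

/-- The matrix `Π(λ)` with entries `∫∫ F_ω(x, y; λ) B_ω'(x, y) dμ(x) dν(y)`, indexed by the pairs
`ω = (k, j)`; the determinant of `Π(λ) - λ I` does not depend on how the pairs are ordered. -/
def PiMatrix (φ : Fin n → Lp ℂ 2 μ) (h : Fin n → Lp ℝ ∞ ν)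
    (ψ : Fin m → Lp ℂ 2 ν) (p : Fin m → Lp ℝ ∞ μ) (l : ℂ) :
    Matrix (Fin m × Fin n) (Fin m × Fin n) ℂ :=
  Matrix.of fun ω ω' => ∫ z, F φ h ψ p l ω z * B φ ψ p ω' z ∂(μ.prod ν)

/-- `Δ(λ) = det (Π(λ) - λ I)`. -/
def Delta (φ : Fin n → Lp ℂ 2 μ) (h : Fin n → Lp ℝ ∞ ν)
    (ψ : Fin m → Lp ℂ 2 ν) (p : Fin m → Lp ℝ ∞ μ) (l : ℂ) : ℂ :=
  (PiMatrix φ h ψ p l - l • (1 : Matrix (Fin m × Fin n) (Fin m × Fin n) ℂ)).det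

end Main

end PartialInt

end

/-!
Under the identification of `L²(μ × ν)` with the Hilbert space tensor product of `L²(μ)` and
`L²(ν)`, the operator `T₁` acts on `φ_k ⊗ L²(ν)` as multiplication by `h_k` and vanishes on the
orthogonal complement of these subspaces; `T₂` has the same form with the factors exchanged. Hence
`(E - τ T_i)⁻¹ = E + τ S_i(τ)`, and `σ(T₁)` consists of `0` and the essential ranges of the `h_k`,
`σ(T₂)` of `0` and those of the `p_j`. As the measures have no atoms, each of these points admits
approximate eigenvectors of `T₁` in every subspace of finite codimension. Taking them of the form
`f ⊗ g` with `g` orthogonal to all `ψ_j`, where `T₂` vanishes, makes them approximate eigenvectors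
of `T` too, and symmetrically for `T₂`; so the discrete spectrum of `T` lies in `G`.

For `τ⁻¹ ∈ G` one has `E - τ T = (E - τ T₁)(E - τ T₂)(E - τ² W₁(τ))`, where the last factor differs
from the identity by an operator of finite rank. Therefore the eigenspace of `T` at `τ⁻¹` is the
finite-dimensional kernel of `E - τ² W₁(τ)`; since `T` is self-adjoint, such an eigenvalue is
isolated in the spectrum. Finally `τ W₁(τ) = ∑ ω, ⟪conj B_ω, ·⟫ F_ω(τ⁻¹)`, so that the eigenvalue
`1` of `τ² W₁(τ)` corresponds to the eigenvalue `τ⁻¹` of the matrix `Π(τ⁻¹)`.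
-/

noncomputable section

namespace PartialInt

open Module.End Filter Topology
open scoped InnerProductSpace

section FiniteRank

theorem hasEigenvalue_iff_exists {K V : Type*} [Field K] [AddCommGroup V] [Module K V]
    {f : Module.End K V} {c : K} : HasEigenvalue f c ↔ ∃ v ≠ 0, f v = c • v := by
  rw [hasEigenvalue_iff, Submodule.ne_bot_iff]
  simp only [mem_eigenspace_iff, and_comm]

theorem hasEigenvalue_smul_iff {K V : Type*} [Field K] [AddCommGroup V] [Module K V]
    {f : Module.End K V} {a c : K} (ha : a ≠ 0) :
    HasEigenvalue (a • f) c ↔ HasEigenvalue f (a⁻¹ * c) := by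
  simp only [hasEigenvalue_iff_exists, LinearMap.smul_apply, mul_smul, eq_inv_smul_iff₀ ha]

theorem fredholmDet_eq_zero_iff {H : Type*} [NormedAddCommGroup H] [NormedSpace ℂ H]
    (A : H →L[ℂ] H) [FiniteDimensional ℂ (A : H →ₗ[ℂ] H).range] :
    fredholmDet A = 0 ↔ HasEigenvalue (A : H →ₗ[ℂ] H) 1 := by
  rw [fredholmDet, LinearMap.det_eq_zero_iff_ker_ne_bot, Submodule.ne_bot_iff,
    hasEigenvalue_iff_exists]
  constructor
  · rintro ⟨v, hv, hv0⟩
    have hAv : (v : H) - A v = 0 := by simpa using congrArg Subtype.val (LinearMap.mem_ker.1 hv)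
    exact ⟨v, by simpa using hv0, by simpa using (sub_eq_zero.1 hAv).symm⟩
  · rintro ⟨v, hv0, hv⟩
    rw [one_smul] at hv
    exact ⟨⟨v, v, hv⟩, Subtype.ext (by simpa [sub_eq_zero] using hv.symm),
      fun h => hv0 (congrArg Subtype.val h)⟩

/-- The coefficients `b ω v` of an eigenvector `v` form an eigenvector of the matrix, and
conversely. -/
theorem hasEigenvalue_sum_smulRight_iff {ι K V : Type*} [Fintype ι] [DecidableEq ι] [Field K]
    [AddCommGroup V] [Module K V] (b : ι → Module.Dual K V) (r : ι → V) {c : K} (hc : c ≠ 0) :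
    HasEigenvalue (∑ ω, (b ω).smulRight (r ω)) c ↔
      (Matrix.of (fun ω ω' => b ω' (r ω)) - c • (1 : Matrix ι ι K)).det = 0 := by
  rw [hasEigenvalue_iff_exists, ← Matrix.exists_vecMul_eq_zero_iff]
  have hvecMul (x : ι → K) : Matrix.vecMul x (Matrix.of (fun ω ω' => b ω' (r ω)) - c • 1) = 0 ↔
      ∀ ω', b ω' (∑ ω, x ω • r ω) = c * x ω' := by
    simp only [funext_iff, Matrix.vecMul_sub, Matrix.vecMul_smul, Matrix.vecMul_one,
      Pi.smul_apply, sub_eq_zero, map_sum, map_smul, smul_eq_mul, Matrix.vecMul,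
      dotProduct, Matrix.of_apply]
  simp only [hvecMul, LinearMap.sum_apply, LinearMap.smulRight_apply]
  constructor
  · rintro ⟨v, hv0, hv⟩
    refine ⟨fun ω => b ω v, fun hb => hv0 ?_, fun ω' => by rw [hv, map_smul, smul_eq_mul]⟩
    rw [← smul_right_injective V hc |>.eq_iff, ← hv, smul_zero]
    exact Finset.sum_eq_zero fun ω _ => by rw [show b ω v = 0 from congrFun hb ω, zero_smul]
  · rintro ⟨x, hx0, hx⟩
    refine ⟨∑ ω, x ω • r ω, fun h0 => hx0 (funext fun ω' => ?_), ?_⟩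
    · simpa [h0, hc] using hx ω'
    · simp only [hx, mul_smul, Finset.smul_sum]

theorem isCompactOperator_of_finiteDimensional_range {𝕜 E F : Type*} [RCLike 𝕜]
    [NormedAddCommGroup E] [NormedSpace 𝕜 E] [NormedAddCommGroup F] [NormedSpace 𝕜 F]
    (A : E →L[𝕜] F) [FiniteDimensional 𝕜 (A : E →ₗ[𝕜] F).range] : IsCompactOperator A := by
  have : ProperSpace (A : E →ₗ[𝕜] F).range := FiniteDimensional.proper_rclike 𝕜 _
  have hid : IsCompactOperator (id : (A : E →ₗ[𝕜] F).range → (A : E →ₗ[𝕜] F).range) :=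
    isCompactOperator_id
  exact (hid.clm_comp (A : E →ₗ[𝕜] F).range.subtypeL).comp_clm A.rangeRestrict

theorem isUnit_one_sub_of_isCompactOperator {𝕜 E : Type*} [NontriviallyNormedField 𝕜]
    [NormedAddCommGroup E] [NormedSpace 𝕜 E] [CompleteSpace E] {K : E →L[𝕜] E}
    (hK : IsCompactOperator K) (hfix : ∀ v, K v = v → v = 0) : IsUnit (1 - K) := by
  have hone : ¬ HasEigenvalue (K : E →ₗ[𝕜] E) 1 := by
    rw [hasEigenvalue_iff_exists]
    rintro ⟨v, hv0, hv⟩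
    exact hv0 (hfix v (by simpa using hv))
  simpa [resolventSet] using (hK.hasEigenvalue_or_mem_resolventSet one_ne_zero).resolve_left hone

end FiniteRank

section IsolatedPoint

theorem isUnit_one_sub_add_smul {𝕜 A : Type*} [Field 𝕜] [Ring A] [Algebra 𝕜 A] {e : A}
    (he : IsIdempotentElem e) {c : 𝕜} (hc : c ≠ 0) : IsUnit (1 - e + c • e) := by
  have hmul (a b : 𝕜) (hab : a * b = 1) : (1 - e + a • e) * (1 - e + b • e) = 1 := by
    rw [mul_add, add_mul, add_mul, he.one_sub.eq, smul_mul_assoc, he.mul_one_sub_self,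
      mul_smul_comm, he.one_sub_mul_self, smul_mul_smul_comm, he.eq, hab, one_smul, smul_zero,
      smul_zero, add_zero, zero_add, sub_add_cancel]
  exact ⟨⟨_, 1 - e + c⁻¹ • e, hmul _ _ (mul_inv_cancel₀ hc), hmul _ _ (inv_mul_cancel₀ hc)⟩, rfl⟩

/-- In `a - w = ((a - w) (1 - e) + e) (1 - e + (z - w) e)` the first factor is invertible for `w`
near `z`, and the second one for `w ≠ z`. -/
theorem eventually_mem_resolventSet_of_mul_eq_smul {𝕜 A : Type*} [NontriviallyNormedField 𝕜]
    [NormedRing A] [NormedAlgebra 𝕜 A] [CompleteSpace A] {a e : A} {z : 𝕜}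
    (he : IsIdempotentElem e) (hae : a * e = z • e) (hu : IsUnit (a - algebraMap 𝕜 A z + e)) :
    ∀ᶠ w in 𝓝[≠] z, w ∈ resolventSet 𝕜 a := by
  have hmul (w : 𝕜) : (a - algebraMap 𝕜 A w) * e = (z - w) • e := by
    rw [sub_mul, hae, Algebra.algebraMap_eq_smul_one, smul_one_mul, sub_smul]
  have hX : ∀ᶠ w in 𝓝 z, IsUnit ((a - algebraMap 𝕜 A w) * (1 - e) + e) := by
    have hcont : Continuous fun w : 𝕜 => (a - algebraMap 𝕜 A w) * (1 - e) + e := by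
      have := continuous_algebraMap 𝕜 A
      fun_prop
    refine (hcont.tendsto z).eventually (Units.isOpen.mem_nhds ?_)
    change IsUnit ((a - algebraMap 𝕜 A z) * (1 - e) + e)
    rwa [mul_sub, mul_one, hmul, sub_self, zero_smul, sub_zero]
  filter_upwards [hX.filter_mono nhdsWithin_le_nhds, self_mem_nhdsWithin] with w hw hwz
  have hfactor : a - algebraMap 𝕜 A w =
      ((a - algebraMap 𝕜 A w) * (1 - e) + e) * (1 - e + (z - w) • e) := by
    rw [mul_add, add_mul, add_mul, mul_assoc, he.one_sub.eq, he.mul_one_sub_self, mul_smul_comm,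
      mul_assoc, he.one_sub_mul_self, mul_smul_comm, he.eq, mul_zero, smul_zero, add_zero, zero_add,
      ← hmul, ← mul_add, sub_add_cancel, mul_one]
  rw [spectrum.mem_resolventSet_iff, ← IsUnit.neg_iff, neg_sub, hfactor]
  exact hw.mul (isUnit_one_sub_add_smul he (sub_ne_zero.2 (Ne.symm hwz)))

theorem sub_smul_mem_orthogonal_eigenspace {𝕜 E : Type*} [RCLike 𝕜] [NormedAddCommGroup E]
    [InnerProductSpace 𝕜 E] {T : Module.End 𝕜 E} (hT : T.IsSymmetric) (z : 𝕜) (v : E) :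
    T v - z • v ∈ (eigenspace T z)ᗮ := by
  intro w hw
  rcases eq_or_ne w 0 with rfl | hw0
  · exact inner_zero_left _
  have hz : conj z = z :=
    hT.conj_eigenvalue_eq_self (hasEigenvalue_of_hasEigenvector ⟨hw, hw0⟩)
  rw [inner_sub_right, ← hT, mem_eigenspace_iff.1 hw, inner_smul_left, inner_smul_right, hz,
    sub_self]

variable {H : Type*} [NormedAddCommGroup H] [InnerProductSpace ℂ H] [CompleteSpace H]

theorem isUnit_sub_add_starProjection_eigenspace {T A K : H →L[ℂ] H} (hT : IsSelfAdjoint T) {z : ℂ}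
    (hA : IsUnit A) (hK : IsCompactOperator K) (hTA : T - algebraMap ℂ (H →L[ℂ] H) z = A * (1 - K))
    [FiniteDimensional ℂ (eigenspace (T : H →ₗ[ℂ] H) z)] :
    IsUnit (T - algebraMap ℂ (H →L[ℂ] H) z +
      (eigenspace (T : H →ₗ[ℂ] H) z).starProjection) := by
  set N := eigenspace (T : H →ₗ[ℂ] H) z
  obtain ⟨A, rfl⟩ := hA
  have hfactor : T - algebraMap ℂ (H →L[ℂ] H) z + N.starProjection =
      A * (1 - (K - (↑A⁻¹ : H →L[ℂ] H) * N.starProjection)) := by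
    rw [hTA, sub_sub_eq_add_sub, add_sub_right_comm, mul_add, Units.mul_inv_cancel_left]
  have hcompact : IsCompactOperator (K - (↑A⁻¹ : H →L[ℂ] H) * N.starProjection) := by
    have : FiniteDimensional ℂ (N.starProjection : H →ₗ[ℂ] H).range := by
      rwa [Submodule.range_starProjection]
    exact hK.sub ((isCompactOperator_of_finiteDimensional_range N.starProjection).clm_comp _)
  rw [hfactor]
  refine A.isUnit.mul (isUnit_one_sub_of_isCompactOperator hcompact fun v hv => ?_)
  have hsum : (T v - z • v) + N.starProjection v = 0 := by
    have h := congrArg (· v) hfactor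
    simpa [hv, Algebra.algebraMap_eq_smul_one] using h
  have hproj : N.starProjection v = 0 := by
    have horth := N.orthogonal.neg_mem (sub_smul_mem_orthogonal_eigenspace hT.isSymmetric z v)
    rw [ContinuousLinearMap.coe_coe, neg_eq_of_add_eq_zero_right hsum] at horth
    exact Submodule.disjoint_def.1 N.orthogonal_disjoint _ (N.starProjection_apply_mem v) horth
  rw [hproj, add_zero, sub_eq_zero] at hsum
  rw [← hproj, Submodule.starProjection_eq_self_iff.2 (mem_eigenspace_iff.2 hsum)]

theorem mem_discreteSpectrum_iff_hasEigenvalue_one {T A K : H →L[ℂ] H} (hT : IsSelfAdjoint T)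
    {z : ℂ} (hA : IsUnit A) (hK : IsCompactOperator K)
    (hTA : T - algebraMap ℂ (H →L[ℂ] H) z = A * (1 - K)) :
    z ∈ discreteSpectrum T ↔ HasEigenvalue (K : H →ₗ[ℂ] H) 1 := by
  have hAinj : Function.Injective A := (ContinuousLinearMap.isUnit_iff_bijective.1 hA).1
  have hker : eigenspace (T : H →ₗ[ℂ] H) z = eigenspace (K : H →ₗ[ℂ] H) 1 := by
    ext v
    have hv : T v - z • v = A (v - K v) := by
      simpa [Algebra.algebraMap_eq_smul_one] using congrArg (· v) hTA
    rw [mem_eigenspace_iff, mem_eigenspace_iff, ContinuousLinearMap.coe_coe, ← sub_eq_zero, hv,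
      map_eq_zero_iff A hAinj, sub_eq_zero, one_smul, eq_comm, ContinuousLinearMap.coe_coe]
  have hfin : FiniteDimensional ℂ (eigenspace (T : H →ₗ[ℂ] H) z) := by
    rw [hker]
    exact ContinuousLinearMap.finite_dimensional_eigenspace hK 1 one_ne_zero
  refine ⟨fun h => by rw [hasEigenvalue_iff, ← hker]; exact h.2.1, fun h => ?_⟩
  have hz : HasEigenvalue (T : H →ₗ[ℂ] H) z := by rwa [hasEigenvalue_iff, hker]
  refine ⟨?_, hz, hfin⟩
  set N := eigenspace (T : H →ₗ[ℂ] H) z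
  have hTN : T * N.starProjection = z • N.starProjection :=
    ContinuousLinearMap.ext fun v => mem_eigenspace_iff.1 (N.starProjection_apply_mem v)
  obtain ⟨ε, hε, hball⟩ := Metric.mem_nhdsWithin_iff.1 <|
    eventually_mem_resolventSet_of_mul_eq_smul N.isIdempotentElem_starProjection hTN
      (isUnit_sub_add_starProjection_eigenspace hT hA hK hTA)
  refine ⟨ε, hε, Set.eq_singleton_iff_unique_mem.2
    ⟨⟨?_, Metric.mem_ball_self hε⟩, fun w hw => ?_⟩⟩
  · rw [ContinuousLinearMap.spectrum_eq]
    exact hz.mem_spectrum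
  · by_contra hwz
    exact hw.1 (hball ⟨hw.2, hwz⟩)

theorem continuousOn_of_isolated {X Y : Type*} [TopologicalSpace X] [T1Space X]
    [TopologicalSpace Y] {f : X → Y} {s : Set X} {z : X} (hz : ∀ᶠ x in 𝓝[≠] z, x ∉ s)
    (hf : ContinuousOn f {z}ᶜ) : ContinuousOn f s := by
  intro x _
  rcases eq_or_ne x z with rfl | hxz
  · have hsing : {x} ∈ 𝓝[s] x := by
      filter_upwards [mem_nhdsWithin_of_mem_nhds (eventually_nhdsWithin_iff.1 hz),
        self_mem_nhdsWithin] with w hw hws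
      exact by_contra fun hwx => hw hwx hws
    exact continuousWithinAt_singleton.mono_of_mem_nhdsWithin hsing
  · exact (hf.continuousAt (isOpen_compl_singleton.mem_nhds hxz)).continuousWithinAt

/-- The functional calculus of `w ↦ (w - z)⁻¹`, with the value `0` at `w = z`, is a left inverse
of `T - z` up to a self-adjoint operator with range in the eigenspace. -/
theorem exists_norm_le_of_isolated {T : H →L[ℂ] H} [IsStarNormal T] {z : ℂ}
    (hz : ∀ᶠ w in 𝓝[≠] z, w ∉ spectrum ℂ T) :
    ∃ C, ∀ v ∈ (eigenspace (T : H →ₗ[ℂ] H) z)ᗮ, ‖v‖ ≤ C * ‖T v - z • v‖ := by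
  set S := T - algebraMap ℂ (H →L[ℂ] H) z with hS
  have hcont : ContinuousOn (fun w : ℂ => (w - z)⁻¹) (spectrum ℂ T) :=
    continuousOn_of_isolated hz <|
      (continuousOn_id.sub continuousOn_const).inv₀ fun w hw => sub_ne_zero.2 hw
  set R := cfc (fun w : ℂ => (w - z)⁻¹) T
  have hcfcS : cfc (fun w : ℂ => w - z) T = S := by rw [cfc_sub .., cfc_id' .., cfc_const ..]
  have hE : 1 - R * S = cfc (fun w : ℂ => 1 - (w - z)⁻¹ * (w - z)) T := by
    rw [cfc_sub .., cfc_mul .., hcfcS, cfc_const_one ..]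
  have hadj : IsSelfAdjoint (1 - R * S) := by
    rw [hE, IsSelfAdjoint, ← cfc_star]
    refine cfc_congr fun w _ => ?_
    rcases eq_or_ne w z with rfl | hw <;> simp [*, sub_ne_zero.2]
  have hSE : S * (1 - R * S) = 0 := by
    rw [hE, ← hcfcS, ← cfc_mul .., ← cfc_zero ℂ T]
    refine cfc_congr fun w _ => ?_
    rcases eq_or_ne w z with rfl | hw <;> simp [*, sub_ne_zero.2]
  have hmem (v : H) : (1 - R * S) v ∈ eigenspace (T : H →ₗ[ℂ] H) z := by
    rw [mem_eigenspace_iff, ← sub_eq_zero]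
    simpa [hS, Algebra.algebraMap_eq_smul_one] using congrArg (· v) hSE
  refine ⟨‖R‖, fun v hv => ?_⟩
  have hzero : (1 - R * S) v = 0 := by
    rw [← inner_self_eq_zero (𝕜 := ℂ)]
    exact (hadj.isSymmetric _ v).symm.trans (hv _ (hmem _))
  have hv' : v = R (T v - z • v) := by
    simpa [hS, Algebra.algebraMap_eq_smul_one, sub_eq_zero] using hzero
  calc ‖v‖ = ‖R (T v - z • v)‖ := by rw [← hv']
    _ ≤ ‖R‖ * ‖T v - z • v‖ := R.le_opNorm _

end IsolatedPoint

section WeylPoint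

variable {𝕜 H : Type*} [RCLike 𝕜] [NormedAddCommGroup H] [InnerProductSpace 𝕜 H]

/-- `l` is a point of the essential spectrum of `A` in the sense of Weyl's criterion: there are
approximate eigenvectors of `A` at `l` in every subspace of finite codimension. -/
def IsWeylPoint (A : H →L[𝕜] H) (l : 𝕜) : Prop :=
  ∀ M : Submodule 𝕜 H, M.CoFG → ∀ ε > 0, ∃ v ∈ M, v ≠ 0 ∧ ‖A v - l • v‖ ≤ ε * ‖v‖

theorem isWeylPoint_zero (hH : ¬ FiniteDimensional 𝕜 H) : IsWeylPoint (0 : H →L[𝕜] H) 0 := by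
  intro M hM ε hε
  have hM0 : M ≠ ⊥ := by
    rintro rfl
    exact hH ((Module.Finite.iff_cofg_bot 𝕜 H).1 hM)
  obtain ⟨v, hv, hv0⟩ := M.ne_bot_iff.1 hM0
  refine ⟨v, hv, hv0, ?_⟩
  rw [zero_apply, zero_smul, sub_zero, norm_zero]
  positivity

theorem IsWeylPoint.not_forall_norm_le {A : H →L[𝕜] H} {l : 𝕜} (hl : IsWeylPoint A l)
    {M : Submodule 𝕜 H} (hM : M.CoFG) (C : ℝ) : ¬ ∀ v ∈ M, ‖v‖ ≤ C * ‖A v - l • v‖ := by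
  intro hC
  obtain ⟨v, hvM, hv0, hv⟩ := hl M hM (|C| + 1)⁻¹ (by positivity)
  have hlt : |C| * (|C| + 1)⁻¹ < 1 := by
    rw [← div_eq_mul_inv, div_lt_one (by positivity)]
    exact lt_add_one _
  have : ‖v‖ < ‖v‖ :=
    calc ‖v‖ ≤ |C| * ‖A v - l • v‖ := (hC v hvM).trans (by gcongr; exact le_abs_self C)
      _ ≤ |C| * ((|C| + 1)⁻¹ * ‖v‖) := by gcongr
      _ = |C| * (|C| + 1)⁻¹ * ‖v‖ := (mul_assoc ..).symm
      _ < ‖v‖ := mul_lt_of_lt_one_left (norm_pos_iff.2 hv0) hlt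
  exact this.false

theorem IsWeylPoint.mem_spectrum {A : H →L[𝕜] H} {l : 𝕜} (hl : IsWeylPoint A l) :
    l ∈ spectrum 𝕜 A := by
  rintro ⟨u, hu⟩
  refine hl.not_forall_norm_le Submodule.CoFG.top ‖(↑u⁻¹ : H →L[𝕜] H)‖ fun v _ => ?_
  have huv : (↑u⁻¹ : H →L[𝕜] H) (l • v - A v) = v := by
    have h := congrArg (· v) u.inv_mul
    simpa only [hu, mul_apply_eq_comp, Algebra.algebraMap_eq_smul_one, sub_apply, smul_apply,
      one_apply_eq_self] using h
  calc ‖v‖ = ‖(↑u⁻¹ : H →L[𝕜] H) (l • v - A v)‖ := by rw [huv]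
    _ ≤ ‖(↑u⁻¹ : H →L[𝕜] H)‖ * ‖A v - l • v‖ := by
      rw [norm_sub_rev]
      exact ContinuousLinearMap.le_opNorm _ _

theorem IsWeylPoint.notMem_discreteSpectrum {H : Type*} [NormedAddCommGroup H]
    [InnerProductSpace ℂ H] [CompleteSpace H] {T : H →L[ℂ] H} [IsStarNormal T] {l : ℂ}
    (hl : IsWeylPoint T l) : l ∉ discreteSpectrum T := by
  rintro ⟨⟨ε, hε, hball⟩, -, hfin⟩
  have hiso : ∀ᶠ w in 𝓝[≠] l, w ∉ spectrum ℂ T := by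
    filter_upwards [nhdsWithin_le_nhds (Metric.ball_mem_nhds l hε), self_mem_nhdsWithin]
      with w hw hwl hwT
    exact hwl (hball.subset ⟨hwT, hw⟩)
  obtain ⟨C, hC⟩ := exists_norm_le_of_isolated hiso
  exact hl.not_forall_norm_le (((Module.Finite.iff_fg).1 hfin).cofg_of_isCompl
    (Submodule.isCompl_orthogonal _)) C hC

end WeylPoint

section EssentialRange

variable {γ : Type*} [MeasurableSpace γ] {ρ : Measure γ}

/-- The essential range of `g`: the values `l` all of whose neighbourhoods have preimages of
positive measure. -/
def essRange {X : Type*} [TopologicalSpace X] (ρ : Measure γ) (g : γ → X) : Set X :=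
  {l | MapClusterPt l (ae ρ) g}

theorem mulOp_mul {g g' : γ → ℂ} (hg : MemLp g ∞ ρ) (hg' : MemLp g' ∞ ρ) :
    mulOp ρ g * mulOp ρ g' = mulOp ρ (g * g') := by
  ext1 f
  refine Lp.ext ?_
  filter_upwards [coeFn_mulOp hg (mulOp ρ g' f), coeFn_mulOp hg' f,
    coeFn_mulOp (hg'.mul hg) f] with z h₁ h₂ h₃
  rw [mul_apply_eq_comp, h₁, h₂, h₃, Pi.mul_apply, mul_assoc]

theorem commute_mulOp {g g' : γ → ℂ} (hg : MemLp g ∞ ρ) (hg' : MemLp g' ∞ ρ) :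
    Commute (mulOp ρ g) (mulOp ρ g') := by
  rw [Commute, SemiconjBy, mulOp_mul hg hg', mulOp_mul hg' hg, mul_comm]

theorem isSymmetric_mulOp {g : γ → ℝ} (hg : MemLp (fun x => (g x : ℂ)) ∞ ρ) :
    (mulOp ρ fun x => (g x : ℂ) : Lp ℂ 2 ρ →ₗ[ℂ] Lp ℂ 2 ρ).IsSymmetric := by
  intro f f'
  rw [ContinuousLinearMap.coe_coe, L2.inner_def, L2.inner_def]
  refine integral_congr_ae ?_
  filter_upwards [coeFn_mulOp hg f, coeFn_mulOp hg f'] with x h₁ h₂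
  rw [h₁, h₂]
  simp only [RCLike.inner_apply, map_mul, Complex.conj_ofReal]
  ring

theorem exists_pos_le_norm_one_sub_mul {𝕜 : Type*} [NormedField 𝕜] {g : γ → 𝕜} {τ : 𝕜}
    (hτ : τ ≠ 0) (hg : τ⁻¹ ∉ essRange ρ g) : ∃ ε > 0, ∀ᵐ x ∂ρ, ε ≤ ‖1 - τ * g x‖ := by
  rw [essRange, mem_ofPred_eq, mapClusterPt_iff_frequently] at hg
  push Not at hg
  obtain ⟨U, hU, hgU⟩ := hg
  obtain ⟨ε, hε, hball⟩ := Metric.mem_nhds_iff.1 hU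
  refine ⟨‖τ‖ * ε, by positivity, ?_⟩
  filter_upwards [hgU] with x hx
  have hle : ε ≤ ‖τ⁻¹ - g x‖ := by
    rw [norm_sub_rev, ← not_lt, ← mem_ball_iff_norm]
    exact fun h => hx (hball h)
  calc ‖τ‖ * ε ≤ ‖τ‖ * ‖τ⁻¹ - g x‖ := by gcongr
    _ = ‖1 - τ * g x‖ := by rw [← norm_mul, mul_sub, mul_inv_cancel₀ hτ]

variable {g : γ → ℂ} {τ : ℂ}

theorem memLp_top_div_one_sub_mul (hg : MemLp g ∞ ρ) (hτ : τ ≠ 0) (hτg : τ⁻¹ ∉ essRange ρ g) :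
    MemLp (fun x => g x / (1 - τ * g x)) ∞ ρ := by
  obtain ⟨ε, hε, hgε⟩ := exists_pos_le_norm_one_sub_mul hτ hτg
  have hinv : MemLp (fun x => (1 - τ * g x)⁻¹) ∞ ρ := by
    refine memLp_top_of_bound
      ((hg.1.aemeasurable.const_mul τ).const_sub 1).inv.aestronglyMeasurable ε⁻¹ ?_
    filter_upwards [hgε] with x hx
    rw [norm_inv]
    exact inv_anti₀ hε hx
  simpa only [div_eq_mul_inv] using hinv.mul' hg

theorem mulOp_div_one_sub_mul (hg : MemLp g ∞ ρ) (hτ : τ ≠ 0) (hτg : τ⁻¹ ∉ essRange ρ g) :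
    mulOp ρ (fun x => g x / (1 - τ * g x)) -
      τ • (mulOp ρ g * mulOp ρ fun x => g x / (1 - τ * g x)) = mulOp ρ g := by
  obtain ⟨ε, hε, hgε⟩ := exists_pos_le_norm_one_sub_mul hτ hτg
  set r := fun x => g x / (1 - τ * g x)
  have hr : MemLp r ∞ ρ := memLp_top_div_one_sub_mul hg hτ hτg
  ext1 f
  refine Lp.ext ?_
  filter_upwards [coeFn_mulOp hg f, coeFn_mulOp hr f, coeFn_mulOp hg (mulOp ρ r f), hgε,
    Lp.coeFn_sub (mulOp ρ r f) (τ • mulOp ρ g (mulOp ρ r f)),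
    Lp.coeFn_smul τ (mulOp ρ g (mulOp ρ r f))] with x h₁ h₂ h₃ hx hsub hsmul
  have hx0 : 1 - τ * g x ≠ 0 := norm_pos_iff.1 (hε.trans_le hx)
  rw [sub_apply, smul_apply, mul_apply_eq_comp, hsub, Pi.sub_apply, hsmul, Pi.smul_apply, h₁, h₃,
    h₂, smul_eq_mul]
  calc r x * f x - τ * (g x * (r x * f x)) = r x * (1 - τ * g x) * f x := by ring
    _ = g x * f x := by rw [div_mul_cancel₀ _ hx0]

end EssentialRange

section NonAtomic

variable {γ : Type*} [MeasurableSpace γ] {ρ : Measure γ}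

theorem exists_measurableSet_inter_diff_ne_zero [MeasurableSpace.CountablySeparated γ]
    [NullSingletonClass ρ] {s : Set γ} (hs : ρ s ≠ 0) :
    ∃ t, MeasurableSet t ∧ ρ (s ∩ t) ≠ 0 ∧ ρ (s \ t) ≠ 0 := by
  by_contra! h
  obtain ⟨t, ht, hst⟩ := exists_subsingleton_mem_of_forall_separating (l := ae (ρ.restrict s))
    MeasurableSet fun U hU => by
      rw [mem_ae_iff, mem_ae_iff, compl_compl, Measure.restrict_apply hU,
        Measure.restrict_apply hU.compl, inter_comm, ← sdiff_eq, inter_comm]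
      exact (em (ρ (s ∩ U) = 0)).symm.imp (h U hU) id
  have hzero : ρ.restrict s t = 0 :=
    le_antisymm ((Measure.restrict_apply_le s t).trans_eq (ht.measure_zero ρ)) (zero_le)
  have huniv : ρ.restrict s univ = 0 := by
    rw [← union_compl_self t]
    exact measure_union_null hzero hst
  exact hs (by rwa [Measure.restrict_apply_univ] at huniv)

/-- The subspace of the functions in `L²(ρ)` that vanish almost everywhere off `s`. -/
def supportedOn (ρ : Measure γ) (s : Set γ) : Submodule ℂ (Lp ℂ 2 ρ) :=
  (LpToLpRestrictCLM γ ℂ ℂ ρ 2 sᶜ).ker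

theorem mem_supportedOn {s : Set γ} {f : Lp ℂ 2 ρ} :
    f ∈ supportedOn ρ s ↔ f =ᵐ[ρ.restrict sᶜ] 0 := by
  rw [supportedOn, LinearMap.mem_ker, ContinuousLinearMap.coe_coe, Lp.eq_zero_iff_ae_eq_zero]
  exact ⟨(LpToLpRestrictCLM_coeFn ℂ sᶜ f).symm.trans, (LpToLpRestrictCLM_coeFn ℂ sᶜ f).trans⟩

theorem supportedOn_mono {s t : Set γ} (hst : s ⊆ t) : supportedOn ρ s ≤ supportedOn ρ t := by
  intro f hf
  rw [mem_supportedOn] at hf ⊢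
  exact ae_mono (Measure.restrict_mono_set ρ (compl_subset_compl.2 hst)) hf

theorem disjoint_supportedOn {s t : Set γ} (hst : Disjoint s t) :
    Disjoint (supportedOn ρ s) (supportedOn ρ t) := by
  rw [Submodule.disjoint_def]
  intro f hs ht
  rw [mem_supportedOn] at hs ht
  rw [Lp.eq_zero_iff_ae_eq_zero]
  exact ae_of_ae_restrict_of_ae_restrict_compl s
    (ae_mono (Measure.restrict_mono_set ρ hst.subset_compl_right) ht) hs

theorem supportedOn_ne_bot [SigmaFinite ρ] {s : Set γ} (hs : NullMeasurableSet s ρ)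
    (hs0 : ρ s ≠ 0) : supportedOn ρ s ≠ ⊥ := by
  obtain ⟨t, hts, ht, hts'⟩ := hs.exists_measurable_subset_ae_eq
  obtain ⟨u, hu, hut, hu0, hutop⟩ := Measure.exists_subset_measure_lt_top ht
    (pos_iff_ne_zero.2 (measure_congr hts' ▸ hs0))
  refine (Submodule.ne_bot_iff _).2 ⟨indicatorConstLp 2 hu hutop.ne 1, ?_, ?_⟩
  · rw [mem_supportedOn]
    have hsu : sᶜ ⊆ uᶜ := compl_subset_compl.2 (hut.trans hts)
    filter_upwards [ae_restrict_of_ae (indicatorConstLp_coeFn (E := ℂ) (p := 2) (c := 1)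
        (hs := hu) (hμs := hutop.ne)),
      ae_mono (Measure.restrict_mono_set ρ hsu) (ae_restrict_mem hu.compl)] with x hx hxu
    rw [hx, indicator_of_notMem hxu, Pi.zero_apply]
  · rw [← norm_pos_iff, norm_indicatorConstLp two_ne_zero ENNReal.ofNat_ne_top, norm_one, one_mul]
    exact Real.rpow_pos_of_pos (ENNReal.toReal_pos hu0.ne' hutop.ne) _

theorem not_finiteDimensional_supportedOn [MeasurableSpace.CountablySeparated γ]
    [NullSingletonClass ρ] [SigmaFinite ρ] {s : Set γ} (hs : NullMeasurableSet s ρ)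
    (hs0 : ρ s ≠ 0) : ¬ FiniteDimensional ℂ (supportedOn ρ s) := by
  intro hfin
  induction hn : Module.finrank ℂ (supportedOn ρ s)
    using Nat.strong_induction_on generalizing s with
  | _ n ih =>
    obtain ⟨t, ht, hst, hst'⟩ := exists_measurableSet_inter_diff_ne_zero hs0
    have hle : supportedOn ρ (s ∩ t) ≤ supportedOn ρ s := supportedOn_mono inter_subset_left
    have hlt : supportedOn ρ (s ∩ t) < supportedOn ρ s := by
      refine hle.lt_of_ne fun heq => supportedOn_ne_bot (hs.diff ht.nullMeasurableSet) hst' ?_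
      exact (disjoint_supportedOn disjoint_sdiff_inter).eq_bot_of_le
        (heq ▸ supportedOn_mono sdiff_subset)
    exact ih _ (hn ▸ Submodule.finrank_lt_finrank_of_lt hlt) (hs.inter ht.nullMeasurableSet) hst
      (Submodule.finiteDimensional_of_le hle) rfl

theorem not_finiteDimensional_Lp_two [MeasurableSpace.CountablySeparated γ] [NullSingletonClass ρ]
    [SigmaFinite ρ] [NeZero ρ] : ¬ FiniteDimensional ℂ (Lp ℂ 2 ρ) := fun _ =>
  not_finiteDimensional_supportedOn (ρ := ρ) nullMeasurableSet_univ
    (Measure.measure_univ_ne_zero.2 (NeZero.ne ρ)) inferInstance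

theorem isWeylPoint_mulOp [MeasurableSpace.CountablySeparated γ] [NullSingletonClass ρ]
    [SigmaFinite ρ] {g : γ → ℂ} (hg : MemLp g ∞ ρ) {l : ℂ} (hl : l ∈ essRange ρ g) :
    IsWeylPoint (mulOp ρ g) l := by
  intro M hM ε hε
  set s := {x | ‖g x - l‖ ≤ ε}
  have hs : NullMeasurableSet s ρ :=
    nullMeasurableSet_le (hg.1.sub aestronglyMeasurable_const).norm.aemeasurable aemeasurable_const
  have hs0 : ρ s ≠ 0 := by
    have h := mapClusterPt_iff_frequently.1 hl _ (Metric.closedBall_mem_nhds l hε)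
    simpa only [mem_closedBall_iff_norm, frequently_ae_iff] using h
  obtain ⟨f, ⟨hfM, hfs⟩, hf0⟩ : ∃ f ∈ M ⊓ supportedOn ρ s, f ≠ 0 := by
    rw [← Submodule.ne_bot_iff, inf_comm, ne_eq, ← disjoint_iff]
    exact fun h => not_finiteDimensional_supportedOn hs hs0
      (Module.Finite.iff_fg.2 (hM.fg_of_disjoint h))
  refine ⟨f, hfM, hf0, Lp.norm_le_mul_norm_of_ae_le_mul ?_⟩
  have hfs' := (ae_restrict_iff'₀ hs.compl).1 (mem_supportedOn.1 hfs)
  filter_upwards [hfs', coeFn_mulOp hg f, Lp.coeFn_sub (mulOp ρ g f) (l • f),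
    Lp.coeFn_smul l f] with x hx hgx hsub hsmul
  rw [hsub, Pi.sub_apply, hsmul, Pi.smul_apply, hgx, smul_eq_mul, ← sub_mul, norm_mul]
  by_cases hxs : x ∈ s
  · gcongr
    exact hxs
  · rw [hx hxs, Pi.zero_apply, norm_zero, mul_zero, mul_zero]

end NonAtomic

theorem IsWeylPoint.of_intertwining {𝕜 F H : Type*} [RCLike 𝕜] [NormedAddCommGroup F]
    [InnerProductSpace 𝕜 F] [NormedAddCommGroup H] [InnerProductSpace 𝕜 H] {A : F →L[𝕜] F} {l : 𝕜}
    (hA : IsWeylPoint A l) {J : F →ₗ[𝕜] H} {c : ℝ} (hc : 0 < c) (hJ : ∀ g, ‖J g‖ = c * ‖g‖)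
    {T : H →L[𝕜] H} {N : Submodule 𝕜 F} (hN : N.CoFG) (hT : ∀ g ∈ N, T (J g) = J (A g)) :
    IsWeylPoint T l := by
  intro M hM ε hε
  have hMJ : (M.comap J).CoFG := by
    rw [← M.ker_mkQ, ← LinearMap.ker_comp]
    have : Module.Finite 𝕜 (H ⧸ M) := hM
    exact Submodule.CoFG.ker _
  obtain ⟨g, ⟨hgM, hgN⟩, hg0, hg⟩ := hA (M.comap J ⊓ N) (hMJ.inf hN) ε hε
  refine ⟨J g, hgM, ?_, ?_⟩
  · rw [← norm_pos_iff, hJ]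
    exact mul_pos hc (norm_pos_iff.2 hg0)
  calc ‖T (J g) - l • J g‖ = c * ‖A g - l • g‖ := by rw [hT g hgN, ← map_smul, ← map_sub, hJ]
    _ ≤ c * (ε * ‖g‖) := by gcongr
    _ = ε * ‖J g‖ := by rw [hJ, mul_left_comm]

section HilbertTensor

variable {𝕜 E F H ι κ : Type*} [RCLike 𝕜] [NormedAddCommGroup E] [InnerProductSpace 𝕜 E]
  [NormedAddCommGroup F] [InnerProductSpace 𝕜 F] [NormedAddCommGroup H] [InnerProductSpace 𝕜 H]
  {t : E →ₗ[𝕜] F →ₗ[𝕜] H}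

/-- `t` exhibits `H` as a Hilbert space tensor product of `E` and `F` (up to completion). -/
structure IsHilbertTensor (t : E →ₗ[𝕜] F →ₗ[𝕜] H) : Prop where
  inner_map : ∀ f f' g g', ⟪t f g, t f' g'⟫_𝕜 = ⟪f, f'⟫_𝕜 * ⟪g, g'⟫_𝕜
  dense_span : Dense (Submodule.span 𝕜 (image2 (fun f g => t f g) univ univ) : Set H)

namespace IsHilbertTensor

theorem flip (ht : IsHilbertTensor t) : IsHilbertTensor t.flip where
  inner_map f f' g g' := by
    simp only [LinearMap.flip_apply, ht.inner_map, mul_comm]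
  dense_span := by
    rw [image2_swap]
    exact ht.dense_span

theorem norm_map (ht : IsHilbertTensor t) (f : E) (g : F) : ‖t f g‖ = ‖f‖ * ‖g‖ := by
  rw [← sq_eq_sq₀ (norm_nonneg _) (by positivity), ← RCLike.ofReal_inj (K := 𝕜), mul_pow]
  push_cast
  rw [← inner_self_eq_norm_sq_to_K, ht.inner_map, inner_self_eq_norm_sq_to_K,
    inner_self_eq_norm_sq_to_K]

theorem ext {G : Type*} [NormedAddCommGroup G] [InnerProductSpace 𝕜 G] (ht : IsHilbertTensor t)
    {S T : H →L[𝕜] G} (h : ∀ f g, S (t f g) = T (t f g)) : S = T :=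
  ContinuousLinearMap.ext_on ht.dense_span <| forall_mem_image2.2 fun f _ g _ => h f g

theorem isSelfAdjoint [CompleteSpace H] (ht : IsHilbertTensor t) {T : H →L[𝕜] H}
    (h : ∀ f g f' g', ⟪T (t f g), t f' g'⟫_𝕜 = ⟪t f g, T (t f' g')⟫_𝕜) : IsSelfAdjoint T := by
  rw [ContinuousLinearMap.isSelfAdjoint_iff']
  refine ht.ext fun f g => ?_
  rw [← innerSL_inj (𝕜 := 𝕜)]
  refine ht.ext fun f' g' => ?_
  rw [innerSL_apply_apply, innerSL_apply_apply, ContinuousLinearMap.adjoint_inner_left, h]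

end IsHilbertTensor

/-- `T` acts as `A k` on the subspace `φ k ⊗ F` for every `k` and, the `φ k` being orthonormal, as
`0` on the orthogonal complement of these subspaces. -/
def IsBlockDiag [Fintype ι] (t : E →ₗ[𝕜] F →ₗ[𝕜] H) (φ : ι → E) (A : ι → F →L[𝕜] F)
    (T : H →L[𝕜] H) : Prop :=
  ∀ f g, T (t f g) = ∑ k, ⟪φ k, f⟫_𝕜 • t (φ k) (A k g)

namespace IsBlockDiag

variable [Fintype ι] [Fintype κ] {φ : ι → E} {ψ : κ → F} {A A' : ι → F →L[𝕜] F} {B : κ → E →L[𝕜] E}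
  {S T : H →L[𝕜] H}

theorem apply_of_mem_orthogonal (hT : IsBlockDiag t φ A T) {f : E}
    (hf : f ∈ (Submodule.span 𝕜 (range φ))ᗮ) (g : F) : T (t f g) = 0 := by
  rw [hT f g]
  exact Finset.sum_eq_zero fun k _ => by
    rw [hf (φ k) (Submodule.subset_span (mem_range_self k)), zero_smul]

theorem apply_self (hT : IsBlockDiag t φ A T) (hφ : Orthonormal 𝕜 φ) (k : ι) (g : F) :
    T (t (φ k) g) = t (φ k) (A k g) := by
  classical
  simp only [hT (φ k) g, orthonormal_iff_ite.1 hφ, ite_smul, one_smul, zero_smul,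
    Finset.sum_ite_eq', Finset.mem_univ, if_true]

theorem isSelfAdjoint [CompleteSpace H] (hT : IsBlockDiag t φ A T) (ht : IsHilbertTensor t)
    (hA : ∀ k, (A k : F →ₗ[𝕜] F).IsSymmetric) : IsSelfAdjoint T := by
  refine ht.isSelfAdjoint fun f g f' g' => ?_
  rw [hT, hT, sum_inner, inner_sum]
  refine Finset.sum_congr rfl fun k _ => ?_
  rw [inner_smul_left, inner_smul_right, ht.inner_map, ht.inner_map, inner_conj_symm,
    ← ContinuousLinearMap.coe_coe, hA k]
  simp only [ContinuousLinearMap.coe_coe]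
  ring

theorem mul (hS : IsBlockDiag t φ A S) (hT : IsBlockDiag t φ A' T) (hφ : Orthonormal 𝕜 φ) :
    IsBlockDiag t φ (A * A') (S * T) := by
  intro f g
  simp only [mul_apply_eq_comp, hT f g, map_sum, map_smul, hS.apply_self hφ, Pi.mul_apply]

theorem commute (hS : IsBlockDiag t φ A S) (hT : IsBlockDiag t φ A' T) (ht : IsHilbertTensor t)
    (hφ : Orthonormal 𝕜 φ) (hA : Commute A A') : Commute S T :=
  ht.ext fun f g => by rw [hS.mul hT hφ, hT.mul hS hφ, hA.eq]

theorem sub_smul_mul_eq (hT : IsBlockDiag t φ A T) (hS : IsBlockDiag t φ A' S)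
    (ht : IsHilbertTensor t) (hφ : Orthonormal 𝕜 φ) {c : 𝕜}
    (hA : ∀ k, A' k - c • (A k * A' k) = A k) : S - c • (T * S) = T := by
  refine ht.ext fun f g => ?_
  rw [sub_apply, smul_apply, hS, hT.mul hS hφ, hT, Finset.smul_sum, ← Finset.sum_sub_distrib]
  refine Finset.sum_congr rfl fun k _ => ?_
  conv_rhs => rw [← hA k]
  rw [smul_comm c, ← smul_sub, ← map_smul, ← map_sub]
  rfl

theorem mul_flip_eq_sum (hS : IsBlockDiag t φ A S) (hT : IsBlockDiag t.flip ψ B T)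
    (ht : IsHilbertTensor t) (hB : ∀ k, (B k : E →ₗ[𝕜] E).IsSymmetric) :
    S * T = ∑ ω : κ × ι, (innerSL 𝕜 (t (B ω.1 (φ ω.2)) (ψ ω.1))).smulRight
      (t (φ ω.2) (A ω.2 (ψ ω.1))) := by
  refine ht.ext fun f g => ?_
  have hTt : T (t f g) = ∑ k, ⟪ψ k, g⟫_𝕜 • t (B k f) (ψ k) := hT g f
  rw [mul_apply_eq_comp, hTt, _root_.sum_apply, Fintype.sum_prod_type, map_sum]
  refine Finset.sum_congr rfl fun k _ => ?_
  rw [map_smul, hS, Finset.smul_sum]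
  refine Finset.sum_congr rfl fun j _ => ?_
  rw [ContinuousLinearMap.smulRight_apply, innerSL_apply_apply, ht.inner_map, smul_smul, mul_comm]
  congr 2
  exact (hB k (φ j) f).symm

theorem isWeylPoint (hT : IsBlockDiag t φ A T) (ht : IsHilbertTensor t) (hφ : Orthonormal 𝕜 φ)
    (hE : ¬ FiniteDimensional 𝕜 E) (hF : ¬ FiniteDimensional 𝕜 F) {N : Submodule 𝕜 F} (hN : N.CoFG)
    (hST : ∀ f, ∀ g ∈ N, S (t f g) = T (t f g)) {l : 𝕜} (hl : l = 0 ∨ ∃ k, IsWeylPoint (A k) l) :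
    IsWeylPoint S l := by
  rcases hl with rfl | ⟨k, hk⟩
  · have := FiniteDimensional.span_of_finite 𝕜 (finite_range φ)
    obtain ⟨f, hf, hf0⟩ : ∃ f ∈ (Submodule.span 𝕜 (range φ))ᗮ, f ≠ 0 := by
      rw [← Submodule.ne_bot_iff, ne_eq, Submodule.orthogonal_eq_bot_iff]
      intro htop
      exact hE (Module.finite_def.2 (htop ▸ Submodule.fg_span (finite_range φ)))
    refine (isWeylPoint_zero hF).of_intertwining (norm_pos_iff.2 hf0) (ht.norm_map f) hN
      fun g hg => ?_
    rw [hST f g hg, hT.apply_of_mem_orthogonal hf, zero_apply, map_zero]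
  · refine hk.of_intertwining (norm_pos_iff.2 (hφ.ne_zero k)) (ht.norm_map (φ k)) hN fun g hg => ?_
    rw [hST _ g hg, hT.apply_self hφ]

end IsBlockDiag

end HilbertTensor

section Tensor

variable {α β : Type*} [MeasurableSpace α] [MeasurableSpace β] {μ : Measure α} {ν : Measure β}

theorem ae_eq_zero_of_forall_setIntegral_prod_eq_zero {E : Type*} [NormedAddCommGroup E]
    [NormedSpace ℝ E] [CompleteSpace E] {u : α × β → E} (hu : Integrable u (μ.prod ν))
    (h : ∀ s t, MeasurableSet s → MeasurableSet t → ∫ z in s ×ˢ t, u z ∂μ.prod ν = 0) :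
    u =ᵐ[μ.prod ν] 0 := by
  suffices hs : ∀ s, MeasurableSet s → ∫ z in s, u z ∂μ.prod ν = 0 from
    hu.ae_eq_zero_of_forall_setIntegral_eq_zero fun s hms _ => hs s hms
  intro s hs
  induction s, hs using MeasurableSpace.induction_on_inter generateFrom_prod.symm
    isPiSystem_prod with
  | empty => rw [setIntegral_empty]
  | basic s hs =>
    obtain ⟨A, hA, C, hC, rfl⟩ := hs
    exact h A C hA hC
  | compl s hs ih =>
    have hadd := integral_add_compl hs hu
    have huniv := h univ univ .univ .univ
    rw [univ_prod_univ, setIntegral_univ] at huniv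
    rwa [ih, huniv, zero_add] at hadd
  | iUnion s hd hs ih =>
    rw [integral_iUnion hs hd hu.integrableOn]
    simp only [ih, tsum_zero]

theorem ae_eq_zero_of_forall_setIntegral_prod_eq_zero_of_sigmaFinite [SigmaFinite μ]
    [SigmaFinite ν] {E : Type*} [NormedAddCommGroup E] [NormedSpace ℝ E] [CompleteSpace E]
    {u : α × β → E} (hu : ∀ s t, μ s < ∞ → ν t < ∞ → IntegrableOn u (s ×ˢ t) (μ.prod ν))
    (h : ∀ s t, MeasurableSet s → MeasurableSet t → μ s < ∞ → ν t < ∞ →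
      ∫ z in s ×ˢ t, u z ∂μ.prod ν = 0) :
    u =ᵐ[μ.prod ν] 0 := by
  have hcover : ⋃ i, spanningSets μ i ×ˢ spanningSets ν i = univ := by
    rw [iUnion_prod_of_monotone (monotone_spanningSets μ) (monotone_spanningSets ν),
      iUnion_spanningSets, iUnion_spanningSets, univ_prod_univ]
  rw [← Measure.restrict_univ (μ := μ.prod ν), ← hcover]
  refine (ae_restrict_iUnion_iff _ _).2 fun i => ?_
  have hμ := measure_spanningSets_lt_top μ i
  have hν := measure_spanningSets_lt_top ν i
  rw [← Measure.prod_restrict]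
  refine ae_eq_zero_of_forall_setIntegral_prod_eq_zero ?_ fun s t hs ht => ?_
  · rw [Measure.prod_restrict]
    exact hu _ _ hμ hν
  · rw [Measure.prod_restrict, Measure.restrict_restrict (hs.prod ht), prod_inter_prod]
    exact h _ _ (hs.inter (measurableSet_spanningSets μ i))
      (ht.inter (measurableSet_spanningSets ν i))
      ((measure_mono inter_subset_right).trans_lt hμ)
      ((measure_mono inter_subset_right).trans_lt hν)

theorem ae_fst {q : α → Prop} (h : ∀ᵐ x ∂μ, q x) : ∀ᵐ z ∂μ.prod ν, q z.1 :=
  Measure.quasiMeasurePreserving_fst.ae h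

theorem ae_snd {q : β → Prop} (h : ∀ᵐ y ∂ν, q y) : ∀ᵐ z ∂μ.prod ν, q z.2 :=
  Measure.quasiMeasurePreserving_snd.ae h

theorem memLp_two_prod_mul {f : α → ℂ} {g : β → ℂ} (hf : MemLp f 2 μ) (hg : MemLp g 2 ν) :
    MemLp (fun z : α × β => f z.1 * g z.2) 2 (μ.prod ν) := by
  have hm : AEStronglyMeasurable (fun z : α × β => f z.1 * g z.2) (μ.prod ν) :=
    hf.1.comp_fst.mul hg.1.comp_snd
  rw [memLp_two_iff_integrable_sq_norm hm]
  simp only [norm_mul, mul_pow]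
  exact (hf.integrable_norm_pow two_ne_zero).mul_prod (hg.integrable_norm_pow two_ne_zero)

/-- The tensor product `(f ⊗ g)(x, y) = f x * g y` of square integrable functions, as a bilinear
map. -/
def tens : Lp ℂ 2 μ →ₗ[ℂ] Lp ℂ 2 ν →ₗ[ℂ] Lp ℂ 2 (μ.prod ν) :=
  LinearMap.mk₂ ℂ (fun f g => (memLp_two_prod_mul (Lp.memLp f) (Lp.memLp g)).toLp _)
    (fun f f' g => by
      rw [← MemLp.toLp_add, MemLp.toLp_eq_toLp_iff]
      filter_upwards [ae_fst (Lp.coeFn_add f f')] with z hz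
      rw [hz, Pi.add_apply, Pi.add_apply, add_mul])
    (fun c f g => by
      rw [← MemLp.toLp_const_smul, MemLp.toLp_eq_toLp_iff]
      filter_upwards [ae_fst (Lp.coeFn_smul c f)] with z hz
      rw [hz, Pi.smul_apply, Pi.smul_apply, smul_mul_assoc])
    (fun f g g' => by
      rw [← MemLp.toLp_add, MemLp.toLp_eq_toLp_iff]
      filter_upwards [ae_snd (Lp.coeFn_add g g')] with z hz
      rw [hz, Pi.add_apply, Pi.add_apply, mul_add])
    (fun c f g => by
      rw [← MemLp.toLp_const_smul, MemLp.toLp_eq_toLp_iff]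
      filter_upwards [ae_snd (Lp.coeFn_smul c g)] with z hz
      rw [hz, Pi.smul_apply, Pi.smul_apply, mul_smul_comm])

theorem coeFn_tens (f : Lp ℂ 2 μ) (g : Lp ℂ 2 ν) :
    tens f g =ᵐ[μ.prod ν] fun z => f z.1 * g z.2 :=
  MemLp.coeFn_toLp (memLp_two_prod_mul (Lp.memLp f) (Lp.memLp g))

theorem inner_tens [SFinite μ] [SFinite ν] (f f' : Lp ℂ 2 μ) (g g' : Lp ℂ 2 ν) :
    ⟪tens f g, tens f' g'⟫_ℂ = ⟪f, f'⟫_ℂ * ⟪g, g'⟫_ℂ := by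
  rw [L2.inner_def, L2.inner_def, L2.inner_def, ← integral_prod_mul]
  refine integral_congr_ae ?_
  filter_upwards [coeFn_tens f g, coeFn_tens f' g'] with z hz hz'
  rw [hz, hz']
  simp only [RCLike.inner_apply, map_mul]
  ring

theorem tens_indicatorConstLp_one {s : Set α} {t : Set β} (hs : MeasurableSet s)
    (ht : MeasurableSet t) (hμs : μ s ≠ ∞) (hνt : ν t ≠ ∞) (hst : μ.prod ν (s ×ˢ t) ≠ ∞) :
    tens (indicatorConstLp 2 hs hμs 1) (indicatorConstLp 2 ht hνt 1) =
      indicatorConstLp 2 (hs.prod ht) hst (1 : ℂ) := by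
  refine Lp.ext ((coeFn_tens _ _).trans ?_)
  filter_upwards [ae_fst (ν := ν) (indicatorConstLp_coeFn (p := 2) (hs := hs) (hμs := hμs)
      (c := (1 : ℂ))), ae_snd (μ := μ) (indicatorConstLp_coeFn (p := 2) (hs := ht) (hμs := hνt)
      (c := (1 : ℂ))), indicatorConstLp_coeFn (p := 2) (hs := hs.prod ht) (hμs := hst)
      (c := (1 : ℂ))] with z hz₁ hz₂ hz
  rw [hz₁, hz₂, hz]
  exact indicator_prod_one.symm

theorem isHilbertTensor_tens [SigmaFinite μ] [SigmaFinite ν] :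
    IsHilbertTensor (tens (μ := μ) (ν := ν)) where
  inner_map := inner_tens
  dense_span := by
    rw [Submodule.dense_iff_topologicalClosure_eq_top, Submodule.topologicalClosure_eq_top_iff,
      Submodule.eq_bot_iff]
    intro u hu
    have hfin : ∀ {s t}, μ s < ∞ → ν t < ∞ → μ.prod ν (s ×ˢ t) ≠ ∞ := fun hs ht => by
      rw [Measure.prod_prod]
      exact ENNReal.mul_ne_top hs.ne ht.ne
    refine Lp.ext (.trans ?_ (Lp.coeFn_zero _ _ _).symm)
    refine ae_eq_zero_of_forall_setIntegral_prod_eq_zero_of_sigmaFinite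
      (fun s t hs ht => integrableOn_Lp_of_measure_ne_top u one_le_two (hfin hs ht))
      fun s t hms hmt hs ht => ?_
    rw [← L2.inner_indicatorConstLp_one (𝕜 := ℂ) (hms.prod hmt) (hfin hs ht),
      ← tens_indicatorConstLp_one hms hmt hs.ne ht.ne]
    exact hu _ (Submodule.subset_span (mem_image2_of_mem (mem_univ _) (mem_univ _)))

end Tensor

section QuasiInverse

variable {R A : Type*} [CommRing R] [Ring A] [Algebra R A] {c : R} {S T T' : A}

theorem one_sub_smul_mul_one_add_smul (hS : S - c • (T * S) = T) :
    (1 - c • T) * (1 + c • S) = 1 := by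
  calc (1 - c • T) * (1 + c • S) = 1 + c • (S - c • (T * S)) - c • T := by
        simp only [sub_mul, mul_add, one_mul, mul_one, smul_mul_assoc, mul_smul_comm, smul_sub]
        abel
    _ = 1 := by rw [hS, add_sub_cancel_right]

theorem one_add_smul_mul_one_sub_smul (hS : S - c • (T * S) = T) (hTS : Commute T S) :
    (1 + c • S) * (1 - c • T) = 1 := by
  have : Commute (1 - c • T) (1 + c • S) :=
    (Commute.one_left _).sub_left (((Commute.one_right T).add_right (hTS.smul_right c)).smul_left c)
  rw [← this.eq, one_sub_smul_mul_one_add_smul hS]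

theorem isUnit_one_sub_smul (hS : S - c • (T * S) = T) (hTS : Commute T S) :
    IsUnit (1 - c • T) :=
  ⟨⟨_, _, one_sub_smul_mul_one_add_smul hS, one_add_smul_mul_one_sub_smul hS hTS⟩, rfl⟩

theorem inverse_one_sub_smul (hS : S - c • (T * S) = T) (hTS : Commute T S) :
    Ring.inverse (1 - c • T) = 1 + c • S :=
  Ring.inverse_unit
    ⟨_, _, one_sub_smul_mul_one_add_smul hS, one_add_smul_mul_one_sub_smul hS hTS⟩

theorem mul_one_sub_sq_smul_inverse_mul (hS : S - c • (T * S) = T) (hT' : IsUnit (1 - c • T')) :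
    (1 - c • T) * (1 - c • T') * (1 - c ^ 2 • (Ring.inverse (1 - c • T') * S * T')) =
      1 - c • (T + T') := by
  have hTS : (1 - c • T) * S = T := by rw [sub_mul, one_mul, smul_mul_assoc, hS]
  calc (1 - c • T) * (1 - c • T') * (1 - c ^ 2 • (Ring.inverse (1 - c • T') * S * T'))
      = (1 - c • T) * (1 - c • T') - c ^ 2 • ((1 - c • T) * S * T') := by
        rw [mul_sub, mul_one, mul_smul_comm, mul_assoc, mul_assoc (Ring.inverse _),
          Ring.mul_inverse_cancel_left _ _ hT', ← mul_assoc]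
    _ = (1 - c • T) * (1 - c • T') - c ^ 2 • (T * T') := by rw [hTS]
    _ = 1 - c • (T + T') := by
        simp only [mul_sub, sub_mul, mul_one, one_mul, smul_mul_assoc, mul_smul_comm, smul_smul,
          smul_add, smul_sub, pow_two]
        abel

theorem inv_mem_resolventSet_iff {K : Type*} [Field K] [Algebra K A] {c : K} (hc : c ≠ 0) :
    c⁻¹ ∈ resolventSet K T ↔ IsUnit (1 - c • T) := by
  rw [spectrum.mem_resolventSet_iff, Algebra.algebraMap_eq_smul_one]
  exact (IsUnit.smul_sub_iff_sub_inv_smul (r := (Units.mk0 c hc)⁻¹) (a := T)).trans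
    (by simp only [Units.smul_def, inv_inv, Units.val_mk0])

end QuasiInverse

section Blocks

variable {α β : Type*} [MeasurableSpace α] [MeasurableSpace β] {μ : Measure α} {ν : Measure β}

theorem memLp_top_comp_quasiMeasurePreserving {c : β → ℂ} (hc : MemLp c ∞ ν) {f : α → β}
    (hf : Measure.QuasiMeasurePreserving f μ ν) : MemLp (fun x => c (f x)) ∞ μ := by
  refine ⟨hc.1.comp_quasiMeasurePreserving hf, lt_of_le_of_lt ?_ hc.2⟩
  rw [eLpNorm_exponent_top, eLpNorm_exponent_top]
  exact essSup_le_of_ae_le _ (hf.ae ae_le_eLpNormEssSup)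

theorem mulOp_snd_tens {c : β → ℂ} (hc : MemLp c ∞ ν) (f : Lp ℂ 2 μ)
    (g : Lp ℂ 2 ν) : mulOp (μ.prod ν) (fun z => c z.2) (tens f g) = tens f (mulOp ν c g) := by
  refine Lp.ext ?_
  filter_upwards [coeFn_mulOp (memLp_top_comp_quasiMeasurePreserving hc
    Measure.quasiMeasurePreserving_snd) (tens f g), coeFn_tens f g, coeFn_tens f (mulOp ν c g),
    ae_snd (μ := μ) (coeFn_mulOp hc g)] with z hmul htens htens' hg
  rw [hmul, htens, htens', hg, mul_left_comm]

theorem mulOp_fst_tens {c : α → ℂ} (hc : MemLp c ∞ μ) (f : Lp ℂ 2 μ)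
    (g : Lp ℂ 2 ν) : mulOp (μ.prod ν) (fun z => c z.1) (tens f g) = tens (mulOp μ c f) g := by
  refine Lp.ext ?_
  filter_upwards [coeFn_mulOp (memLp_top_comp_quasiMeasurePreserving hc
    Measure.quasiMeasurePreserving_fst) (tens f g), coeFn_tens f g, coeFn_tens (mulOp μ c f) g,
    ae_fst (ν := ν) (coeFn_mulOp hc f)] with z hmul htens htens' hf
  rw [hmul, htens, htens', hf, mul_assoc]

variable [SFinite μ] [SFinite ν]

theorem P_tens (φ f : Lp ℂ 2 μ) (g : Lp ℂ 2 ν) : P φ (tens f g) = ⟪φ, f⟫_ℂ • tens φ g := by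
  refine Lp.ext ((coeFn_P φ _).trans ((projFun₁_congr (coeFn_tens f g)).trans ?_))
  filter_upwards [Lp.coeFn_smul ⟪φ, f⟫_ℂ (tens φ g), coeFn_tens φ g] with z hsmul htens
  rw [hsmul, Pi.smul_apply, htens, L2.inner_def, projFun₁, smul_eq_mul, ← integral_mul_const]
  simp only [RCLike.inner_apply]
  refine integral_congr_ae (.of_forall fun s => ?_)
  ring

theorem Q_tens (ψ g : Lp ℂ 2 ν) (f : Lp ℂ 2 μ) : Q ψ (tens f g) = ⟪ψ, g⟫_ℂ • tens f ψ := by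
  refine Lp.ext ((coeFn_Q ψ _).trans ((projFun₂_congr (coeFn_tens f g)).trans ?_))
  filter_upwards [Lp.coeFn_smul ⟪ψ, g⟫_ℂ (tens f ψ), coeFn_tens f ψ] with z hsmul htens
  rw [hsmul, Pi.smul_apply, htens, L2.inner_def, projFun₂, smul_eq_mul, ← integral_mul_const]
  simp only [RCLike.inner_apply]
  refine integral_congr_ae (.of_forall fun t => ?_)
  ring

variable {ι : Type*} [Fintype ι]

theorem isBlockDiag_sum_mulOp_comp_P (φ : ι → Lp ℂ 2 μ) {c : ι → β → ℂ}
    (hc : ∀ k, MemLp (c k) ∞ ν) :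
    IsBlockDiag tens φ (fun k => mulOp ν (c k))
      (∑ k, mulOp (μ.prod ν) (fun z => c k z.2) ∘L P (φ k)) := by
  intro f g
  rw [_root_.sum_apply]
  refine Finset.sum_congr rfl fun k _ => ?_
  rw [ContinuousLinearMap.comp_apply, P_tens, map_smul, mulOp_snd_tens (hc k)]

theorem isBlockDiag_sum_mulOp_comp_Q (ψ : ι → Lp ℂ 2 ν) {c : ι → α → ℂ}
    (hc : ∀ k, MemLp (c k) ∞ μ) :
    IsBlockDiag tens.flip ψ (fun k => mulOp μ (c k))
      (∑ k, mulOp (μ.prod ν) (fun z => c k z.1) ∘L Q (ψ k)) := by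
  intro g f
  rw [_root_.sum_apply]
  refine Finset.sum_congr rfl fun k _ => ?_
  rw [ContinuousLinearMap.comp_apply, LinearMap.flip_apply, Q_tens, map_smul, mulOp_fst_tens (hc k),
    LinearMap.flip_apply]

end Blocks

theorem cofg_orthogonal_span_range {𝕜 E ι : Type*} [RCLike 𝕜] [NormedAddCommGroup E]
    [InnerProductSpace 𝕜 E] [Finite ι] (v : ι → E) : (Submodule.span 𝕜 (range v))ᗮ.CoFG :=
  have := FiniteDimensional.span_of_finite 𝕜 (finite_range v)
  (Submodule.fg_span (finite_range v)).cofg_of_isCompl (Submodule.isCompl_orthogonal _)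

theorem memLp_ofReal {γ : Type*} [MeasurableSpace γ] {ρ : Measure γ} (g : Lp ℝ ∞ ρ) :
    MemLp (fun x => (g x : ℂ)) ∞ ρ :=
  (Lp.memLp g).ofReal

section Operators

variable {α β : Type*} [MeasurableSpace α] [MeasurableSpace β] {μ : Measure α} {ν : Measure β}
  {n m : ℕ} {φ : Fin n → Lp ℂ 2 μ} {h : Fin n → Lp ℝ ∞ ν} {ψ : Fin m → Lp ℂ 2 ν}
  {p : Fin m → Lp ℝ ∞ μ} {τ l : ℂ}

section SFinite

variable [SFinite μ] [SFinite ν]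

/-- The counterpart `∑ⱼ pⱼ(x) / (1 - τ pⱼ(x)) * Qⱼ` of `S₁ φ h τ` for the operator `T₂ ψ p`. -/
def S₂ (ψ : Fin m → Lp ℂ 2 ν) (p : Fin m → Lp ℝ ∞ μ) (τ : ℂ) :
    Lp ℂ 2 (μ.prod ν) →L[ℂ] Lp ℂ 2 (μ.prod ν) :=
  ∑ j, mulOp (μ.prod ν) (fun z => (p j z.1 : ℂ) / (1 - τ * (p j z.1 : ℂ))) ∘L Q (ψ j)

theorem isBlockDiag_T₁ : IsBlockDiag tens φ (fun k => mulOp ν fun y => (h k y : ℂ)) (T₁ φ h) := by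
  rw [T₁, ContinuousLinearMap.copy_eq]
  exact isBlockDiag_sum_mulOp_comp_P φ fun k => memLp_ofReal (h k)

theorem isBlockDiag_T₂ :
    IsBlockDiag tens.flip ψ (fun j => mulOp μ fun x => (p j x : ℂ)) (T₂ ψ p) := by
  rw [T₂, ContinuousLinearMap.copy_eq]
  exact isBlockDiag_sum_mulOp_comp_Q ψ fun j => memLp_ofReal (p j)

theorem isBlockDiag_S₁ (hτ : τ ≠ 0) (hh : ∀ k, τ⁻¹ ∉ essRange ν fun y => (h k y : ℂ)) :
    IsBlockDiag tens φ (fun k => mulOp ν fun y => (h k y : ℂ) / (1 - τ * (h k y : ℂ)))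
      (S₁ φ h τ) :=
  isBlockDiag_sum_mulOp_comp_P φ fun k => memLp_top_div_one_sub_mul (memLp_ofReal (h k)) hτ (hh k)

theorem isBlockDiag_S₂ (hτ : τ ≠ 0) (hp : ∀ j, τ⁻¹ ∉ essRange μ fun x => (p j x : ℂ)) :
    IsBlockDiag tens.flip ψ (fun j => mulOp μ fun x => (p j x : ℂ) / (1 - τ * (p j x : ℂ)))
      (S₂ ψ p τ) :=
  isBlockDiag_sum_mulOp_comp_Q ψ fun j => memLp_top_div_one_sub_mul (memLp_ofReal (p j)) hτ (hp j)

end SFinite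

variable [SigmaFinite μ] [SigmaFinite ν]

theorem isSelfAdjoint_T₁ : IsSelfAdjoint (T₁ φ h) :=
  isBlockDiag_T₁.isSelfAdjoint isHilbertTensor_tens fun k =>
    isSymmetric_mulOp (memLp_ofReal (h k))

theorem isSelfAdjoint_T₂ : IsSelfAdjoint (T₂ ψ p) :=
  isBlockDiag_T₂.isSelfAdjoint isHilbertTensor_tens.flip fun j =>
    isSymmetric_mulOp (memLp_ofReal (p j))

theorem S₁_sub_smul_T₁_mul_S₁ (hφ : Orthonormal ℂ φ) (hτ : τ ≠ 0)
    (hh : ∀ k, τ⁻¹ ∉ essRange ν fun y => (h k y : ℂ)) :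
    S₁ φ h τ - τ • (T₁ φ h * S₁ φ h τ) = T₁ φ h :=
  isBlockDiag_T₁.sub_smul_mul_eq (isBlockDiag_S₁ hτ hh) isHilbertTensor_tens hφ fun k =>
    mulOp_div_one_sub_mul (memLp_ofReal (h k)) hτ (hh k)

theorem S₂_sub_smul_T₂_mul_S₂ (hψ : Orthonormal ℂ ψ) (hτ : τ ≠ 0)
    (hp : ∀ j, τ⁻¹ ∉ essRange μ fun x => (p j x : ℂ)) :
    S₂ ψ p τ - τ • (T₂ ψ p * S₂ ψ p τ) = T₂ ψ p :=
  isBlockDiag_T₂.sub_smul_mul_eq (isBlockDiag_S₂ hτ hp) isHilbertTensor_tens.flip hψ fun j =>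
    mulOp_div_one_sub_mul (memLp_ofReal (p j)) hτ (hp j)

theorem commute_T₁_S₁ (hφ : Orthonormal ℂ φ) (hτ : τ ≠ 0)
    (hh : ∀ k, τ⁻¹ ∉ essRange ν fun y => (h k y : ℂ)) : Commute (T₁ φ h) (S₁ φ h τ) :=
  isBlockDiag_T₁.commute (isBlockDiag_S₁ hτ hh) isHilbertTensor_tens hφ <| Pi.commute_iff.2
    fun k => commute_mulOp (memLp_ofReal (h k))
      (memLp_top_div_one_sub_mul (memLp_ofReal (h k)) hτ (hh k))

theorem commute_T₂_S₂ (hψ : Orthonormal ℂ ψ) (hτ : τ ≠ 0)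
    (hp : ∀ j, τ⁻¹ ∉ essRange μ fun x => (p j x : ℂ)) : Commute (T₂ ψ p) (S₂ ψ p τ) :=
  isBlockDiag_T₂.commute (isBlockDiag_S₂ hτ hp) isHilbertTensor_tens.flip hψ <| Pi.commute_iff.2
    fun j => commute_mulOp (memLp_ofReal (p j))
      (memLp_top_div_one_sub_mul (memLp_ofReal (p j)) hτ (hp j))

theorem isUnit_one_sub_smul_T₁ (hφ : Orthonormal ℂ φ) (hτ : τ ≠ 0)
    (hh : ∀ k, τ⁻¹ ∉ essRange ν fun y => (h k y : ℂ)) : IsUnit (1 - τ • T₁ φ h) :=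
  isUnit_one_sub_smul (S₁_sub_smul_T₁_mul_S₁ hφ hτ hh) (commute_T₁_S₁ hφ hτ hh)

theorem isUnit_one_sub_smul_T₂ (hψ : Orthonormal ℂ ψ) (hτ : τ ≠ 0)
    (hp : ∀ j, τ⁻¹ ∉ essRange μ fun x => (p j x : ℂ)) : IsUnit (1 - τ • T₂ ψ p) :=
  isUnit_one_sub_smul (S₂_sub_smul_T₂_mul_S₂ hψ hτ hp) (commute_T₂_S₂ hψ hτ hp)

section Spectrum

variable [MeasurableSpace.CountablySeparated α] [NullSingletonClass μ] [NeZero μ]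
  [MeasurableSpace.CountablySeparated β] [NullSingletonClass ν] [NeZero ν]

theorem isWeylPoint_of_eq_T₁ (hφ : Orthonormal ℂ φ) {S : Lp ℂ 2 (μ.prod ν) →L[ℂ] Lp ℂ 2 (μ.prod ν)}
    {N : Submodule ℂ (Lp ℂ 2 ν)} (hN : N.CoFG)
    (hS : ∀ f, ∀ g ∈ N, S (tens f g) = T₁ φ h (tens f g))
    (hl : l = 0 ∨ ∃ k, l ∈ essRange ν fun y => (h k y : ℂ)) : IsWeylPoint S l :=
  isBlockDiag_T₁.isWeylPoint isHilbertTensor_tens hφ not_finiteDimensional_Lp_two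
    not_finiteDimensional_Lp_two hN hS <|
    hl.imp_right <| .imp fun k => isWeylPoint_mulOp (memLp_ofReal (h k))

theorem isWeylPoint_of_eq_T₂ (hψ : Orthonormal ℂ ψ) {S : Lp ℂ 2 (μ.prod ν) →L[ℂ] Lp ℂ 2 (μ.prod ν)}
    {N : Submodule ℂ (Lp ℂ 2 μ)} (hN : N.CoFG)
    (hS : ∀ g, ∀ f ∈ N, S (tens f g) = T₂ ψ p (tens f g))
    (hl : l = 0 ∨ ∃ j, l ∈ essRange μ fun x => (p j x : ℂ)) : IsWeylPoint S l :=
  isBlockDiag_T₂.isWeylPoint isHilbertTensor_tens.flip hψ not_finiteDimensional_Lp_two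
    not_finiteDimensional_Lp_two hN hS <|
    hl.imp_right <| .imp fun j => isWeylPoint_mulOp (memLp_ofReal (p j))

theorem mem_spectrum_T₁_iff (hφ : Orthonormal ℂ φ) :
    l ∈ spectrum ℂ (T₁ φ h) ↔ l = 0 ∨ ∃ k, l ∈ essRange ν fun y => (h k y : ℂ) := by
  refine ⟨fun hl => ?_, fun hl =>
    (isWeylPoint_of_eq_T₁ hφ .top (fun _ _ _ => rfl) hl).mem_spectrum⟩
  contrapose! hl
  rw [← inv_inv l] at hl ⊢
  have hl0 : l⁻¹ ≠ 0 := inv_ne_zero (inv_inv l ▸ hl.1)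
  exact not_not.2 <| (inv_mem_resolventSet_iff hl0).2 <| isUnit_one_sub_smul_T₁ hφ hl0 hl.2

theorem mem_spectrum_T₂_iff (hψ : Orthonormal ℂ ψ) :
    l ∈ spectrum ℂ (T₂ ψ p) ↔ l = 0 ∨ ∃ j, l ∈ essRange μ fun x => (p j x : ℂ) := by
  refine ⟨fun hl => ?_, fun hl =>
    (isWeylPoint_of_eq_T₂ hψ .top (fun _ _ _ => rfl) hl).mem_spectrum⟩
  contrapose! hl
  rw [← inv_inv l] at hl ⊢
  have hl0 : l⁻¹ ≠ 0 := inv_ne_zero (inv_inv l ▸ hl.1)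
  exact not_not.2 <| (inv_mem_resolventSet_iff hl0).2 <| isUnit_one_sub_smul_T₂ hψ hl0 hl.2

theorem mem_G_iff (hφ : Orthonormal ℂ φ) (hψ : Orthonormal ℂ ψ) :
    l ∈ G φ h ψ p ↔ l ≠ 0 ∧ (∀ k, l ∉ essRange ν fun y => (h k y : ℂ)) ∧
      ∀ j, l ∉ essRange μ fun x => (p j x : ℂ) := by
  rw [G, mem_compl_iff, mem_union, mem_spectrum_T₁_iff hφ, mem_spectrum_T₂_iff hψ]
  push Not
  tauto

theorem discreteSpectrum_subset_G (hφ : Orthonormal ℂ φ) (hψ : Orthonormal ℂ ψ) :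
    discreteSpectrum (T₁ φ h + T₂ ψ p) ⊆ G φ h ψ p := by
  have : IsStarNormal (T₁ φ h + T₂ ψ p) := (isSelfAdjoint_T₁.add isSelfAdjoint_T₂).isStarNormal
  rintro l hl (hl₁ | hl₂)
  · refine (isWeylPoint_of_eq_T₁ (N := (Submodule.span ℂ (range ψ))ᗮ) hφ ?_ (fun f g hg => ?_)
      ((mem_spectrum_T₁_iff hφ).1 hl₁)).notMem_discreteSpectrum hl
    · exact cofg_orthogonal_span_range ψ
    · have : T₂ ψ p (tens f g) = 0 := isBlockDiag_T₂.apply_of_mem_orthogonal hg f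
      rw [add_apply, this, add_zero]
  · refine (isWeylPoint_of_eq_T₂ (N := (Submodule.span ℂ (range φ))ᗮ) hψ ?_ (fun g f hf => ?_)
      ((mem_spectrum_T₂_iff hψ).1 hl₂)).notMem_discreteSpectrum hl
    · exact cofg_orthogonal_span_range φ
    · rw [add_apply, isBlockDiag_T₁.apply_of_mem_orthogonal hf g, zero_add]

end Spectrum

end Operators

theorem div_inv_sub {K : Type*} [Field K] {τ : K} (hτ : τ ≠ 0) (x : K) :
    x / (τ⁻¹ - x) = τ * (x / (1 - τ * x)) := by
  rw [← mul_div_mul_left x _ hτ, mul_sub, mul_inv_cancel₀ hτ, mul_div_assoc]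

theorem coeFn_smul_mulOp_div_one_sub_mul {γ : Type*} [MeasurableSpace γ] {ρ : Measure γ}
    {g : γ → ℂ} (hg : MemLp g ∞ ρ) {τ : ℂ} (hτ : τ ≠ 0) (hτg : τ⁻¹ ∉ essRange ρ g)
    (f : Lp ℂ 2 ρ) :
    ⇑(τ • mulOp ρ (fun x => g x / (1 - τ * g x)) f) =ᵐ[ρ] fun x => g x / (τ⁻¹ - g x) * f x := by
  filter_upwards [Lp.coeFn_smul τ (mulOp ρ (fun x => g x / (1 - τ * g x)) f),
    coeFn_mulOp (memLp_top_div_one_sub_mul hg hτ hτg) f] with x hsmul hmul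
  rw [hsmul, Pi.smul_apply, hmul, smul_eq_mul, ← mul_assoc, div_inv_sub hτ]

section FiniteRank

variable {α β : Type*} [MeasurableSpace α] [MeasurableSpace β] {μ : Measure α} {ν : Measure β}
  {n m : ℕ} {φ : Fin n → Lp ℂ 2 μ} {h : Fin n → Lp ℝ ∞ ν} {ψ : Fin m → Lp ℂ 2 ν}
  {p : Fin m → Lp ℝ ∞ μ} {τ : ℂ}

/-- The complex conjugates `p_k φ_j ⊗ ψ_k` of the functions `B_{k,j}` as elements of `L²`. -/
def conjB (φ : Fin n → Lp ℂ 2 μ) (ψ : Fin m → Lp ℂ 2 ν) (p : Fin m → Lp ℝ ∞ μ)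
    (ω : Fin m × Fin n) : Lp ℂ 2 (μ.prod ν) :=
  tens (mulOp μ (fun x => (p ω.1 x : ℂ)) (φ ω.2)) (ψ ω.1)

theorem coeFn_conjB (ω : Fin m × Fin n) :
    conjB φ ψ p ω =ᵐ[μ.prod ν] fun z => conj (B φ ψ p ω z) := by
  filter_upwards [coeFn_tens (mulOp μ (fun x => (p ω.1 x : ℂ)) (φ ω.2)) (ψ ω.1),
    ae_fst (ν := ν) (coeFn_mulOp (memLp_ofReal (p ω.1)) (φ ω.2))] with z htens hmul
  rw [conjB, htens, hmul, B, map_mul, map_mul, Complex.conj_conj, Complex.conj_conj,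
    Complex.conj_ofReal]

theorem coeFn_sum_smul_tens {ι : Type*} [Fintype ι] (c : ι → ℂ) (f : ι → Lp ℂ 2 μ)
    (g : ι → Lp ℂ 2 ν) :
    ⇑(∑ i, c i • tens (f i) (g i)) =ᵐ[μ.prod ν] fun z => ∑ i, c i * (f i z.1 * g i z.2) := by
  filter_upwards [coeFn_sum_ae Finset.univ fun i => c i • tens (f i) (g i),
    ae_all_iff.2 fun i => Lp.coeFn_smul (c i) (tens (f i) (g i)),
    ae_all_iff.2 fun i => coeFn_tens (f i) (g i)] with z hsum hsmul htens
  rw [hsum]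
  exact Finset.sum_congr rfl fun i _ => by rw [hsmul, Pi.smul_apply, htens, smul_eq_mul]

variable [SFinite μ] [SFinite ν]

/-- The functions `F_{k,j}(·, ·; τ⁻¹)` as elements of `L²`, obtained by applying
`(E - τ T₂)⁻¹ = E + τ S₂(τ)` to elementary tensors. -/
def toLpF (φ : Fin n → Lp ℂ 2 μ) (h : Fin n → Lp ℝ ∞ ν) (ψ : Fin m → Lp ℂ 2 ν)
    (p : Fin m → Lp ℝ ∞ μ) (τ : ℂ) (ω : Fin m × Fin n) : Lp ℂ 2 (μ.prod ν) :=
  (1 + τ • S₂ ψ p τ) (tens (φ ω.2)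
    (τ • mulOp ν (fun y => (h ω.2 y : ℂ) / (1 - τ * (h ω.2 y : ℂ))) (ψ ω.1)))

theorem toLpF_eq_tens_add_sum (hτ : τ ≠ 0) (hp : ∀ j, τ⁻¹ ∉ essRange μ fun x => (p j x : ℂ))
    (ω : Fin m × Fin n) {u : Lp ℂ 2 ν}
    (hu : τ • mulOp ν (fun y => (h ω.2 y : ℂ) / (1 - τ * (h ω.2 y : ℂ))) (ψ ω.1) = u) :
    toLpF φ h ψ p τ ω = tens (φ ω.2) u + ∑ i, ⟪ψ i, u⟫_ℂ •
      tens (τ • mulOp μ (fun x => (p i x : ℂ) / (1 - τ * (p i x : ℂ))) (φ ω.2)) (ψ i) := by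
  have hS₂ := isBlockDiag_S₂ (ψ := ψ) hτ hp u (φ ω.2)
  simp only [LinearMap.flip_apply] at hS₂
  rw [toLpF, hu, add_apply, one_apply_eq_self, smul_apply, hS₂, Finset.smul_sum]
  refine congrArg _ (Finset.sum_congr rfl fun i _ => ?_)
  rw [smul_comm, map_smul tens, LinearMap.smul_apply]

theorem coeFn_toLpF (hτ : τ ≠ 0) (hh : ∀ k, τ⁻¹ ∉ essRange ν fun y => (h k y : ℂ))
    (hp : ∀ j, τ⁻¹ ∉ essRange μ fun x => (p j x : ℂ)) (ω : Fin m × Fin n) :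
    toLpF φ h ψ p τ ω =ᵐ[μ.prod ν] F φ h ψ p τ⁻¹ ω := by
  set u : Lp ℂ 2 ν := τ • mulOp ν (fun y => (h ω.2 y : ℂ) / (1 - τ * (h ω.2 y : ℂ))) (ψ ω.1)
    with hu_def
  set v : Fin m → Lp ℂ 2 μ := fun i =>
    τ • mulOp μ (fun x => (p i x : ℂ) / (1 - τ * (p i x : ℂ))) (φ ω.2)
  have hu : u =ᵐ[ν] fun y => (h ω.2 y : ℂ) / (τ⁻¹ - (h ω.2 y : ℂ)) * ψ ω.1 y :=
    coeFn_smul_mulOp_div_one_sub_mul (memLp_ofReal (h ω.2)) hτ (hh ω.2) (ψ ω.1)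
  have hv : ∀ i, v i =ᵐ[μ] fun x => (p i x : ℂ) / (τ⁻¹ - (p i x : ℂ)) * φ ω.2 x := fun i =>
    coeFn_smul_mulOp_div_one_sub_mul (memLp_ofReal (p i)) hτ (hp i) (φ ω.2)
  have hinner : ∀ i, ⟪ψ i, u⟫_ℂ =
      ∫ ξ, (h ω.2 ξ : ℂ) / (τ⁻¹ - (h ω.2 ξ : ℂ)) * ψ ω.1 ξ * conj (ψ i ξ) ∂ν := fun i => by
    rw [L2.inner_def]
    refine integral_congr_ae ?_
    filter_upwards [hu] with ξ hξ
    rw [hξ, RCLike.inner_apply]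
  rw [toLpF_eq_tens_add_sum hτ hp ω hu_def.symm]
  filter_upwards [Lp.coeFn_add (tens (φ ω.2) u) (∑ i, ⟪ψ i, u⟫_ℂ • tens (v i) (ψ i)),
    coeFn_tens (φ ω.2) u, coeFn_sum_smul_tens (fun i => ⟪ψ i, u⟫_ℂ) v ψ, ae_snd (μ := μ) hu,
    ae_all_iff.2 fun i => ae_fst (ν := ν) (hv i)] with z hadd htens hsum hu hv
  rw [hadd, Pi.add_apply, htens, hsum, hu, F, mul_add, Finset.mul_sum]
  congr 1
  · ring
  refine Finset.sum_congr rfl fun i _ => ?_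
  rw [hv, hinner]
  ring

theorem inner_conjB_toLpF (hτ : τ ≠ 0) (hh : ∀ k, τ⁻¹ ∉ essRange ν fun y => (h k y : ℂ))
    (hp : ∀ j, τ⁻¹ ∉ essRange μ fun x => (p j x : ℂ)) (ω ω' : Fin m × Fin n) :
    ⟪conjB φ ψ p ω', toLpF φ h ψ p τ ω⟫_ℂ = PiMatrix φ h ψ p τ⁻¹ ω ω' := by
  rw [L2.inner_def, PiMatrix, Matrix.of_apply]
  refine integral_congr_ae ?_
  filter_upwards [coeFn_toLpF hτ hh hp ω, coeFn_conjB ω'] with z hF hB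
  rw [hF, hB, RCLike.inner_apply, Complex.conj_conj]

theorem inv_mem_D₀_iff :
    τ⁻¹ ∈ D₀ φ h ψ p ↔
      τ ≠ 0 ∧ τ⁻¹ ∈ G φ h ψ p ∧ fredholmDet (τ ^ 2 • W₁ φ h ψ p τ) = 0 := by
  have hG : τ⁻¹ ∈ G φ h ψ p ↔ τ⁻¹ ∈ resolventSet ℂ (T₁ φ h) ∩ resolventSet ℂ (T₂ ψ p) := by
    simp only [G, spectrum, compl_union, compl_compl]
  have hD₀ : τ⁻¹ ∈ D₀ φ h ψ p ↔ τ ∈ D φ h ψ p := by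
    simp only [D₀, one_div, inv_inj, mem_ofPred_eq, exists_eq_right']
  rw [hD₀, hG, D, mem_ofPred_eq]

end FiniteRank

section Factorization

variable {α β : Type*} [MeasurableSpace α] [MeasurableSpace β] {μ : Measure α} {ν : Measure β}
  [SigmaFinite μ] [SigmaFinite ν] {n m : ℕ} {φ : Fin n → Lp ℂ 2 μ} {h : Fin n → Lp ℝ ∞ ν}
  {ψ : Fin m → Lp ℂ 2 ν} {p : Fin m → Lp ℝ ∞ μ} {τ : ℂ}

theorem smul_W₁_eq_sum_smulRight (hψ : Orthonormal ℂ ψ) (hτ : τ ≠ 0)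
    (hh : ∀ k, τ⁻¹ ∉ essRange ν fun y => (h k y : ℂ))
    (hp : ∀ j, τ⁻¹ ∉ essRange μ fun x => (p j x : ℂ)) :
    τ • W₁ φ h ψ p τ =
      ∑ ω, (innerSL ℂ (conjB φ ψ p ω)).smulRight (toLpF φ h ψ p τ ω) := by
  ext1 f
  rw [W₁, inverse_one_sub_smul (S₂_sub_smul_T₂_mul_S₂ hψ hτ hp) (commute_T₂_S₂ hψ hτ hp),
    mul_assoc, (isBlockDiag_S₁ hτ hh).mul_flip_eq_sum isBlockDiag_T₂ isHilbertTensor_tens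
      fun j => isSymmetric_mulOp (memLp_ofReal (p j))]
  simp only [smul_apply, mul_apply_eq_comp, sum_apply, ContinuousLinearMap.smulRight_apply,
    innerSL_apply_apply, map_sum, map_smul, Finset.smul_sum, conjB, toLpF]
  exact Finset.sum_congr rfl fun ω _ => smul_comm _ _ _

theorem finiteDimensional_range_sq_smul_W₁ (hψ : Orthonormal ℂ ψ) (hτ : τ ≠ 0)
    (hh : ∀ k, τ⁻¹ ∉ essRange ν fun y => (h k y : ℂ))
    (hp : ∀ j, τ⁻¹ ∉ essRange μ fun x => (p j x : ℂ)) :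
    FiniteDimensional ℂ (LinearMap.range
      ((τ ^ 2 • W₁ φ h ψ p τ : Lp ℂ 2 (μ.prod ν) →L[ℂ] Lp ℂ 2 (μ.prod ν)) :
        Lp ℂ 2 (μ.prod ν) →ₗ[ℂ] Lp ℂ 2 (μ.prod ν))) := by
  have := FiniteDimensional.span_of_finite ℂ (finite_range (toLpF φ h ψ p τ))
  refine Submodule.finiteDimensional_of_le (S₂ := .span ℂ (range (toLpF φ h ψ p τ))) ?_
  rintro _ ⟨f, rfl⟩
  rw [sq, mul_smul, smul_W₁_eq_sum_smulRight hψ hτ hh hp]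
  simp only [ContinuousLinearMap.coe_coe, smul_apply, sum_apply,
    ContinuousLinearMap.smulRight_apply]
  exact Submodule.smul_mem _ _ <| sum_mem fun ω _ =>
    Submodule.smul_mem _ _ <| Submodule.subset_span (mem_range_self ω)

theorem fredholmDet_sq_smul_W₁_eq_zero_iff (hψ : Orthonormal ℂ ψ) (hτ : τ ≠ 0)
    (hh : ∀ k, τ⁻¹ ∉ essRange ν fun y => (h k y : ℂ))
    (hp : ∀ j, τ⁻¹ ∉ essRange μ fun x => (p j x : ℂ)) :
    fredholmDet (τ ^ 2 • W₁ φ h ψ p τ) = 0 ↔ Delta φ h ψ p τ⁻¹ = 0 := by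
  have := finiteDimensional_range_sq_smul_W₁ (φ := φ) hψ hτ hh hp
  have hsum : ((τ • W₁ φ h ψ p τ : Lp ℂ 2 (μ.prod ν) →L[ℂ] Lp ℂ 2 (μ.prod ν)) :
      Lp ℂ 2 (μ.prod ν) →ₗ[ℂ] Lp ℂ 2 (μ.prod ν)) =
      ∑ ω, (innerₛₗ ℂ (conjB φ ψ p ω)).smulRight (toLpF φ h ψ p τ ω) := by
    rw [smul_W₁_eq_sum_smulRight hψ hτ hh hp]
    ext1 f
    simp
  have hPi : (Matrix.of fun ω ω' => innerₛₗ ℂ (conjB φ ψ p ω') (toLpF φ h ψ p τ ω)) =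
      PiMatrix φ h ψ p τ⁻¹ := Matrix.ext fun ω ω' => inner_conjB_toLpF hτ hh hp ω ω'
  rw [fredholmDet_eq_zero_iff, sq, mul_smul, ContinuousLinearMap.toLinearMap_smul,
    hasEigenvalue_smul_iff hτ, mul_one, hsum, hasEigenvalue_sum_smulRight_iff _ _ (inv_ne_zero hτ),
    hPi, Delta]

theorem inv_mem_discreteSpectrum_iff (hφ : Orthonormal ℂ φ) (hψ : Orthonormal ℂ ψ) (hτ : τ ≠ 0)
    (hh : ∀ k, τ⁻¹ ∉ essRange ν fun y => (h k y : ℂ))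
    (hp : ∀ j, τ⁻¹ ∉ essRange μ fun x => (p j x : ℂ)) :
    τ⁻¹ ∈ discreteSpectrum (T₁ φ h + T₂ ψ p) ↔ fredholmDet (τ ^ 2 • W₁ φ h ψ p τ) = 0 := by
  have := finiteDimensional_range_sq_smul_W₁ (φ := φ) hψ hτ hh hp
  have hT₁ := isUnit_one_sub_smul_T₁ hφ hτ hh
  have hT₂ := isUnit_one_sub_smul_T₂ hψ hτ hp
  rw [fredholmDet_eq_zero_iff]
  refine mem_discreteSpectrum_iff_hasEigenvalue_one (isSelfAdjoint_T₁.add isSelfAdjoint_T₂)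
    ((hT₁.mul hT₂).smul (Units.mk0 (-τ⁻¹) (neg_ne_zero.2 (inv_ne_zero hτ))))
    (isCompactOperator_of_finiteDimensional_range _) ?_
  rw [Units.smul_mk0, smul_mul_assoc, W₁,
    mul_one_sub_sq_smul_inverse_mul (S₁_sub_smul_T₁_mul_S₁ hφ hτ hh) hT₂, smul_sub, smul_smul,
    neg_mul, inv_mul_cancel₀ hτ, Algebra.algebraMap_eq_smul_one]
  module

section Spectrum

variable [MeasurableSpace.CountablySeparated α] [NullSingletonClass μ] [NeZero μ]
  [MeasurableSpace.CountablySeparated β] [NullSingletonClass ν] [NeZero ν]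

theorem discreteSpectrum_eq_D₀ (hφ : Orthonormal ℂ φ) (hψ : Orthonormal ℂ ψ) :
    discreteSpectrum (T₁ φ h + T₂ ψ p) = D₀ φ h ψ p := by
  ext l
  obtain ⟨τ, rfl⟩ : ∃ τ, τ⁻¹ = l := ⟨l⁻¹, inv_inv l⟩
  rw [inv_mem_D₀_iff]
  constructor
  · intro hl
    have hG := discreteSpectrum_subset_G hφ hψ hl
    obtain ⟨hτ, hh, hp⟩ := (mem_G_iff hφ hψ).1 hG
    have hτ := inv_eq_zero.not.1 hτ
    exact ⟨hτ, hG, (inv_mem_discreteSpectrum_iff hφ hψ hτ hh hp).1 hl⟩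
  · rintro ⟨hτ, hG, hdet⟩
    obtain ⟨-, hh, hp⟩ := (mem_G_iff hφ hψ).1 hG
    exact (inv_mem_discreteSpectrum_iff hφ hψ hτ hh hp).2 hdet

theorem D₀_eq_setOf_Delta_eq_zero (hφ : Orthonormal ℂ φ) (hψ : Orthonormal ℂ ψ) :
    D₀ φ h ψ p = {l | l ∈ G φ h ψ p ∧ Delta φ h ψ p l = 0} := by
  ext l
  obtain ⟨τ, rfl⟩ : ∃ τ, τ⁻¹ = l := ⟨l⁻¹, inv_inv l⟩
  have hiff (hG : τ⁻¹ ∈ G φ h ψ p) :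
      τ ≠ 0 ∧ fredholmDet (τ ^ 2 • W₁ φ h ψ p τ) = 0 ↔ Delta φ h ψ p τ⁻¹ = 0 := by
    obtain ⟨hτ, hh, hp⟩ := (mem_G_iff hφ hψ).1 hG
    have hτ := inv_eq_zero.not.1 hτ
    rw [and_iff_right hτ, fredholmDet_sq_smul_W₁_eq_zero_iff hψ hτ hh hp]
  rw [inv_mem_D₀_iff, and_left_comm, mem_ofPred_eq]
  exact and_congr_right hiff

end Spectrum

end Factorization

end PartialInt

end

theorem theorem5p5_general {α β : Type*} [MeasurableSpace α] [MeasurableSpace β]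
    [MeasurableSpace.CountablySeparated α] [MeasurableSpace.CountablySeparated β]
    {μ : Measure α} {ν : Measure β} [SigmaFinite μ] [SigmaFinite ν]
    [NullSingletonClass μ] [NullSingletonClass ν] [NeZero μ] [NeZero ν] {n m : ℕ}
    {φ : Fin n → Lp ℂ 2 μ} (hφ : Orthonormal ℂ φ) (h : Fin n → Lp ℝ ∞ ν)
    {ψ : Fin m → Lp ℂ 2 ν} (hψ : Orthonormal ℂ ψ) (p : Fin m → Lp ℝ ∞ μ) :
    PartialInt.discreteSpectrum (PartialInt.T₁ φ h + PartialInt.T₂ ψ p) = PartialInt.D₀ φ h ψ p ∧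
    PartialInt.D₀ φ h ψ p = {l | l ∈ PartialInt.G φ h ψ p ∧ PartialInt.Delta φ h ψ p l = 0} :=
  ⟨PartialInt.discreteSpectrum_eq_D₀ hφ hψ, PartialInt.D₀_eq_setOf_Delta_eq_zero hφ hψ⟩

theorem theorem5p5 (a b c d : ℝ) (hab : a < b) (hcd : c < d) (n m : ℕ)
    (φ : Fin n → Lp ℂ 2 (volume.restrict (Icc a b))) (hφ : Orthonormal ℂ φ)
    (h : Fin n → Lp ℝ ∞ (volume.restrict (Icc c d)))
    (ψ : Fin m → Lp ℂ 2 (volume.restrict (Icc c d))) (hψ : Orthonormal ℂ ψ)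
    (p : Fin m → Lp ℝ ∞ (volume.restrict (Icc a b))) :
    PartialInt.discreteSpectrum (PartialInt.T₁ φ h + PartialInt.T₂ ψ p) = PartialInt.D₀ φ h ψ p ∧
    PartialInt.D₀ φ h ψ p = {l | l ∈ PartialInt.G φ h ψ p ∧ PartialInt.Delta φ h ψ p l = 0} := by
  have hμ : NeZero (volume.restrict (Icc a b)) :=
    ⟨mt Measure.restrict_eq_zero.1 (by simpa using hab)⟩
  have hν : NeZero (volume.restrict (Icc c d)) :=
    ⟨mt Measure.restrict_eq_zero.1 (by simpa using hcd)⟩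
  exact theorem5p5_general hφ h hψ p
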